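/- Let $n\ge 2$ be a prime power, $q=n^3$, and let $K=\mathbb{F}_{q^2}$. Put $h(X)=\sum_{i=0}^{n}(-1)^{i+1}X^{i(n-1)}$. Let $\mathcal X\subset\mathbb P^3$ be the GK curve over $K$, i.e. the projective curve with affine equations $$Z^{n^2-n+1}=Y\,h(X),\qquad X^n+X=Y^{n+1},$$ let $x,y,z$ be the coordinate functions, so that its function field is $F=K(x,y,z)$, the field of fractions of $K[X,Y,Z]/(Z^{n^2-n+1}-Yh(X),\,X^n+X-Y^{n+1})$. For an affine $K$-rational point $(a,b,c)$ of $\mathcal X$ let $P_{(a,b,c)}$ denote the corresponding place of $F/K$ (the place whose valuation ring is the local ring of $\mathcal X$ at that point); put $P_0=P_{(0,0,0)}$, and let $P_\infty$ be the place of the point at infinity $(1:0:0:0)$. Then all these places exist, and the principal divisors of $x,y,z$ in the divisor group of $F/K$ are as follows. 1. $(x)=(n^3+1)P_0-(n^3+1)P_\infty$. 2. The equation $a^n+a=0$ has exactly $n$ roots $a_1,\dots,a_n$ in $K$, and $$(y)=\sum_{i=1}^{n}(n^2-n+1)P_{(a_i,0,0)}-n(n^2-n+1)P_\infty .$$ 3.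 For $a,b\in K$, the point $(a,b,0)$ lies on $\mathcal X$ if and only if $a,b\in\mathbb F_{n^2}$ and $a^n+a=b^{n+1}$; there are exactly $n^3$ such points $(a_i,b_i,0)$, $i=1,\dots,n^3$, and $$(z)=\sum_{i=1}^{n^3}P_{(a_i,b_i,0)}-n^3P_\infty .$$ -/

import Mathlib

open MvPolynomial

namespace GK

/-- The polynomial `h(T) = ∑_{i=0}^{n} (-1)^{i+1} T^{i(n-1)}`, evaluated at an element of a ring. -/
def h (n : ℕ) {R : Type*} [CommRing R] (t : R) : R :=
  ∑ i ∈ Finset.range (n + 1), (-1) ^ (i + 1) * t ^ (i * (n - 1))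

/-- The exponent `n² - n + 1` (here `n ≤ n²`, so the subtraction is an honest one). -/
abbrev m (n : ℕ) : ℕ := n ^ 2 - n + 1

/-- The two affine equations of the GK curve, for elements of a ring. -/
def OnCurve (n : ℕ) {R : Type*} [CommRing R] (a b c : R) : Prop :=
  c ^ m n = b * h n a ∧ a ^ n + a = b ^ (n + 1)

instance (n : ℕ) {R : Type*} [CommRing R] [DecidableEq R] (a b c : R) :
    Decidable (OnCurve n a b c) :=
  inferInstanceAs (Decidable (_ ∧ _))

section Helpers

theorem map_h (n : ℕ) {R S : Type*} [CommRing R] [CommRing S] (f : R →+* S) (t : R) :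
    f (h n t) = h n (f t) := by
  simp [h]

theorem h_zero (n : ℕ) (hn : 2 ≤ n) {R : Type*} [CommRing R] : h n (0 : R) = -1 := by
  unfold h
  rw [Finset.sum_eq_single 0]
  · simp
  · intro i _ hi
    have : i * (n - 1) ≠ 0 := Nat.mul_ne_zero hi (by omega)
    simp [this]
  · simp

theorem m_mul (n : ℕ) : (n + 1) * m n = n ^ 3 + 1 := by
  have : n ≤ n ^ 2 := by nlinarith [Nat.le_self_pow (two_ne_zero) n]
  obtain ⟨k, hk⟩ := Nat.exists_eq_add_of_le this
  have : m n = k + 1 := by simp [m, hk]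
  rw [this]
  zify at hk ⊢
  have : (k : ℤ) = n ^ 2 - n := by linarith
  rw [this]; ring

end Helpers

/-- The ideal of `K[X, Y, Z]` generated by the two equations of the GK curve. -/
noncomputable def curveIdeal (n : ℕ) (K : Type*) [Field K] : Ideal (MvPolynomial (Fin 3) K) :=
  Ideal.span {X 2 ^ m n - X 1 * h n (X 0), X 0 ^ n + X 0 - X 1 ^ (n + 1)}

/-- The affine coordinate ring `K[X, Y, Z] / (Z^{n²-n+1} - Y h(X), X^n + X - Y^{n+1})`. -/
abbrev CoordinateRing (n : ℕ) (K : Type*) [Field K] : Type _ :=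
  MvPolynomial (Fin 3) K ⧸ curveIdeal n K

section Domain

variable (n : ℕ) (K : Type*) [Field K]

/-- The class of the `i`-th coordinate in the coordinate ring. -/
noncomputable def coord (i : Fin 3) : CoordinateRing n K := Ideal.Quotient.mk _ (X i)

theorem coord_onCurve : OnCurve n (coord n K 0) (coord n K 1) (coord n K 2) := by
  constructor
  · have := Ideal.subset_span (s := {X 2 ^ m n - X 1 * h n (X 0),
      X 0 ^ n + X 0 - X 1 ^ (n + 1)}) (Set.mem_insert (X 2 ^ m n - X 1 * h n (X 0)
        : MvPolynomial (Fin 3) K) _)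
    have := Ideal.Quotient.eq_zero_iff_mem.2 this
    rw [map_sub, map_mul, map_pow, map_h, sub_eq_zero] at this
    exact this
  · have := Ideal.subset_span (s := {X 2 ^ m n - X 1 * h n (X 0),
      X 0 ^ n + X 0 - X 1 ^ (n + 1)}) (Set.mem_insert_of_mem _ (Set.mem_singleton
        (X 0 ^ n + X 0 - X 1 ^ (n + 1) : MvPolynomial (Fin 3) K)))
    have := Ideal.Quotient.eq_zero_iff_mem.2 this
    rw [map_sub, map_add, map_pow, map_pow, sub_eq_zero] at this
    exact this

/-- Every element of the coordinate ring is a combination of the monomials `y^i z^j`,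
`i ≤ n`, `j < n² - n + 1`, with coefficients polynomials in `x`. -/
theorem exists_rep (r : CoordinateRing n K) :
    ∃ c : Fin (n + 1) × Fin (m n) → Polynomial K,
      ∑ ij, Polynomial.aeval (coord n K 0) (c ij) *
        (coord n K 1 ^ (ij.1 : ℕ) * coord n K 2 ^ (ij.2 : ℕ)) = r := by
  let _ : Algebra (Polynomial K) (CoordinateRing n K) :=
    (Polynomial.aeval (coord n K 0)).toRingHom.toAlgebra
  have hsm : ∀ (c : Polynomial K) (r : CoordinateRing n K),
      c • r = Polynomial.aeval (coord n K 0) c * r := fun c r => Algebra.smul_def c r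
  set v : Fin (n + 1) × Fin (m n) → CoordinateRing n K := fun ij =>
    coord n K 1 ^ (ij.1 : ℕ) * coord n K 2 ^ (ij.2 : ℕ) with hv
  set M := Submodule.span (Polynomial K) (Set.range v) with hM
  have hmem : ∀ i j : ℕ, i < n + 1 → j < m n → coord n K 1 ^ i * coord n K 2 ^ j ∈ M :=
    fun i j hi hj => Submodule.subset_span ⟨(⟨i, hi⟩, ⟨j, hj⟩), rfl⟩
  obtain ⟨e1, e2⟩ := coord_onCurve n K
  have hx : ∀ r ∈ M, coord n K 0 * r ∈ M := fun r hr => by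
    have := M.smul_mem Polynomial.X hr
    rwa [hsm, Polynomial.aeval_X] at this
  have hpol : ∀ (p : Polynomial K), ∀ r ∈ M, Polynomial.aeval (coord n K 0) p * r ∈ M :=
    fun p r hr => by
    have := M.smul_mem p hr
    rwa [hsm] at this
  have hclose : ∀ t : CoordinateRing n K, (∀ ij, t * v ij ∈ M) → ∀ r ∈ M, t * r ∈ M := by
    intro t ht r hr
    induction hr using Submodule.span_induction with
    | mem x hx => obtain ⟨ij, rfl⟩ := hx; exact ht ij
    | zero => simp
    | add a b _ _ ha hb => rw [mul_add]; exact M.add_mem ha hb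
    | smul c a _ ha => rw [mul_smul_comm]; exact M.smul_mem c ha
  have hy : ∀ r ∈ M, coord n K 1 * r ∈ M := by
    refine hclose _ ?_
    rintro ⟨⟨i, hi⟩, ⟨j, hj⟩⟩
    simp only [hv]
    rcases Nat.lt_or_ge (i + 1) (n + 1) with h1 | h1
    · have := hmem (i + 1) j h1 hj
      rwa [pow_succ', mul_assoc] at this
    · obtain rfl : i = n := by omega
      rw [← mul_assoc, ← pow_succ', ← e2]
      have h0 := hmem 0 j (by omega) hj
      rw [pow_zero, one_mul] at h0
      have := hpol (Polynomial.X ^ i + Polynomial.X) _ h0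
      simpa using this
  have hz : ∀ r ∈ M, coord n K 2 * r ∈ M := by
    refine hclose _ ?_
    rintro ⟨⟨i, hi⟩, ⟨j, hj⟩⟩
    simp only [hv]
    rcases Nat.lt_or_ge (j + 1) (m n) with h1 | h1
    · have := hmem i (j + 1) hi h1
      rwa [pow_succ', mul_left_comm] at this
    · have hj' : j + 1 = m n := by omega
      have h0 := hmem i 0 hi (by simp [m])
      rw [pow_zero, mul_one] at h0
      have := hy _ (hpol (h n Polynomial.X) _ h0)
      have hh : Polynomial.aeval (coord n K 0) (h n (Polynomial.X : Polynomial K))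
          = h n (coord n K 0) := by
        have := map_h n (Polynomial.aeval (coord n K 0)).toRingHom (Polynomial.X : Polynomial K)
        simpa using this
      rw [hh] at this
      rw [mul_left_comm, ← pow_succ', hj', e1]
      convert this using 1
      ring
  have htop : ∀ r, r ∈ M := by
    intro r
    obtain ⟨p, rfl⟩ := Ideal.Quotient.mk_surjective r
    induction p using MvPolynomial.induction_on with
    | C a =>
      have h0 := hmem 0 0 (by omega) (by simp [m])
      have := hpol (Polynomial.C a) _ h0
      simp only [pow_zero, mul_one, Polynomial.aeval_C] at this
      exact this
    | add p q hp hq => rw [map_add]; exact M.add_mem hp hq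
    | mul_X p i hp =>
      rw [map_mul, mul_comm]
      fin_cases i
      · exact hx _ hp
      · exact hy _ hp
      · exact hz _ hp
  obtain ⟨c, hc⟩ := (Submodule.mem_span_range_iff_exists_fun _).1 (htop r)
  refine ⟨c, ?_⟩
  rw [← hc]
  exact Finset.sum_congr rfl fun ij _ => (hsm _ _).symm

/-- The polynomial `T^{n³+1} - (x^n + x) h(x)^{n+1}` over `K[x]`, satisfied by `z`. -/
noncomputable def zPoly : Polynomial (Polynomial K) :=
  Polynomial.X ^ (n ^ 3 + 1) -
    Polynomial.C ((Polynomial.X ^ n + Polynomial.X) * h n Polynomial.X ^ (n + 1))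

theorem zPoly_monic : (zPoly n K).Monic :=
  Polynomial.monic_X_pow_sub_C _ (by omega)

theorem zPoly_irreducible (hn : 2 ≤ n) : Irreducible (zPoly n K) := by
  have hdeg : (zPoly n K).natDegree = n ^ 3 + 1 := Polynomial.natDegree_X_pow_sub_C
  have hdeg' : (zPoly n K).degree = (n ^ 3 + 1 : ℕ) := by
    rw [Polynomial.degree_eq_natDegree (zPoly_monic n K).ne_zero, hdeg]
  refine Polynomial.irreducible_of_eisenstein_criterion
    (P := Ideal.span {(Polynomial.X : Polynomial K)}) ?_ ?_ ?_ ?_ ?_ (zPoly_monic n K).isPrimitive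
  · exact (Ideal.span_singleton_prime Polynomial.X_ne_zero).2 Polynomial.prime_X
  · rw [(zPoly_monic n K).leadingCoeff, Ideal.mem_span_singleton]
    exact Polynomial.prime_X.not_dvd_one
  · intro k hk
    rw [hdeg'] at hk
    have hk : k < n ^ 3 + 1 := by exact_mod_cast hk
    rw [Ideal.mem_span_singleton, zPoly, Polynomial.coeff_sub, Polynomial.coeff_X_pow,
      if_neg hk.ne, Polynomial.coeff_C]
    split_ifs
    · rw [zero_sub, dvd_neg]
      refine Dvd.dvd.mul_right (dvd_add (dvd_pow_self _ (by omega)) dvd_rfl) _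
    · simp
  · rw [hdeg']; exact_mod_cast Nat.succ_pos _
  · rw [Ideal.span_singleton_pow, Ideal.mem_span_singleton, zPoly, Polynomial.coeff_sub,
      Polynomial.coeff_X_pow, if_neg (by omega), Polynomial.coeff_C, if_pos rfl, zero_sub, dvd_neg]
    have : (Polynomial.X ^ n + Polynomial.X : Polynomial K) * h n Polynomial.X ^ (n + 1)
        = Polynomial.X * ((Polynomial.X ^ (n - 1) + 1) * h n Polynomial.X ^ (n + 1)) := by
      obtain ⟨k, rfl⟩ : ∃ k, n = k + 1 := ⟨n - 1, by omega⟩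
      simp only [Nat.add_sub_cancel]; ring
    rw [this, sq]
    intro hdvd
    have := (mul_dvd_mul_iff_left Polynomial.X_ne_zero).1 hdvd
    rw [Polynomial.X_dvd_iff, Polynomial.coeff_zero_eq_eval_zero] at this
    have hh : Polynomial.eval 0 (h n (Polynomial.X : Polynomial K)) = -1 := by
      have := map_h n (Polynomial.evalRingHom (0 : K)) Polynomial.X
      simpa [h_zero n hn] using this
    have h1 : n - 1 ≠ 0 := by omega
    simp [hh, h1] at this

theorem coordinateRing_isDomain (hn : 2 ≤ n) : IsDomain (CoordinateRing n K) := by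
  let L := RatFunc K
  let g : Polynomial L := (zPoly n K).map (algebraMap (Polynomial K) L)
  have hg : Irreducible g :=
    ((zPoly_monic n K).irreducible_iff_irreducible_map_fraction_map (K := L)).1
      (zPoly_irreducible n K hn)
  have hgm : g.Monic := (zPoly_monic n K).map _
  have hgd : g.natDegree = (n + 1) * m n := by
    rw [m_mul, (zPoly_monic n K).natDegree_map]
    exact Polynomial.natDegree_X_pow_sub_C
  have : Fact (Irreducible g) := ⟨hg⟩
  let E := AdjoinRoot g
  let x : L := algebraMap (Polynomial K) L Polynomial.X
  let z : E := AdjoinRoot.root g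
  have hhx : h n x = algebraMap (Polynomial K) L (h n Polynomial.X) := (map_h n _ _).symm
  have hh0 : h n x ≠ 0 := by
    rw [hhx, Ne, map_eq_zero_iff _ (IsFractionRing.injective (Polynomial K) L)]
    intro h0
    have := map_h n (Polynomial.evalRingHom (0 : K)) Polynomial.X
    rw [h0] at this
    simp [h_zero n hn] at this
  have hE0 : algebraMap L E (h n x) ≠ 0 := (map_ne_zero _).2 hh0
  let y : E := z ^ m n * (algebraMap L E (h n x))⁻¹
  have hz : z ^ (n ^ 3 + 1) = algebraMap L E ((x ^ n + x) * h n x ^ (n + 1)) := by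
    have : Polynomial.aeval z g = 0 := by
      rw [Polynomial.aeval_def]; exact AdjoinRoot.eval₂_root g
    simp only [g, zPoly, Polynomial.map_sub, Polynomial.map_pow, Polynomial.map_X,
      Polynomial.map_C, map_sub, map_pow, Polynomial.aeval_X, Polynomial.aeval_C, map_mul,
      map_add, sub_eq_zero] at this
    rw [this, hhx]
    simp [x]
  let f : MvPolynomial (Fin 3) K →+* E :=
    (MvPolynomial.aeval ![algebraMap L E x, y, z]).toRingHom
  have f0 : f (X 0) = algebraMap L E x := by simp [f]
  have f1 : f (X 1) = y := by simp [f]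
  have f2 : f (X 2) = z := by simp [f]
  have hf : ∀ a ∈ curveIdeal n K, f a = 0 := by
    intro a ha
    have : curveIdeal n K ≤ RingHom.ker f := by
      rw [curveIdeal, Ideal.span_le]
      intro b hb
      rcases hb with rfl | rfl
      · simp only [SetLike.mem_coe, RingHom.mem_ker, map_sub, map_pow, map_mul, map_h, f0, f1, f2]
        rw [← map_h, sub_eq_zero]
        exact (inv_mul_cancel_right₀ hE0 _).symm
      · simp only [SetLike.mem_coe, RingHom.mem_ker, map_sub, map_pow, map_add, f0, f1]
        rw [sub_eq_zero, mul_pow, ← pow_mul, mul_comm (m n), m_mul, hz, map_mul, map_pow, inv_pow,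
          mul_inv_cancel_right₀ (pow_ne_zero _ hE0), map_add, map_pow]
    exact this ha
  let φ : CoordinateRing n K →+* E := Ideal.Quotient.lift _ f hf
  have φ0 : φ (coord n K 0) = algebraMap L E x := f0
  have φ1 : φ (coord n K 1) = y := f1
  have φ2 : φ (coord n K 2) = z := f2
  have φp : ∀ p : Polynomial K, φ (Polynomial.aeval (coord n K 0) p)
      = algebraMap L E (algebraMap (Polynomial K) L p) := by
    intro p
    have : φ.comp (Polynomial.aeval (coord n K 0)).toRingHom
        = (algebraMap L E).comp (algebraMap (Polynomial K) L) := by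
      apply Polynomial.ringHom_ext
      · intro a
        have h1 : φ (algebraMap K (CoordinateRing n K) a) = f (C a) := rfl
        have h2 : f (C a) = algebraMap K E a := by simp [f]
        simp only [RingHom.comp_apply, AlgHom.toRingHom_eq_coe, RingHom.coe_coe,
          Polynomial.aeval_C, h1, h2]
        rw [IsScalarTower.algebraMap_apply K L E]
        congr 1
      · simp [φ0, x]
    exact congrArg (fun t => t p) this
  have hli := linearIndependent_pow (K := L) z
  have hmp : (minpoly L z).natDegree = (n + 1) * m n := by
    have := AdjoinRoot.minpoly_root (f := g) hgm.ne_zero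
    rw [hgm.leadingCoeff, inv_one, map_one, mul_one] at this
    rw [this, hgd]
  have hli' : LinearIndependent L (fun ij : Fin (n + 1) × Fin (m n) =>
      z ^ (finProdFinEquiv ij : ℕ)) := by
    have := hli.comp (fun ij : Fin (n + 1) × Fin (m n) => Fin.cast hmp.symm (finProdFinEquiv ij))
      ((Fin.cast_injective _).comp finProdFinEquiv.injective)
    exact this
  have hinj : Function.Injective φ := by
    rw [injective_iff_map_eq_zero]
    intro r hr
    obtain ⟨c, rfl⟩ := exists_rep n K r
    have hc : ∀ ij, c ij = 0 := by
      rw [map_sum] at hr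
      have := Fintype.linearIndependent_iff.1 hli'
        (fun ij => algebraMap (Polynomial K) L (c ij) * ((h n x) ^ (ij.1 : ℕ))⁻¹) (by
          rw [← hr]
          refine Finset.sum_congr rfl fun ij _ => ?_
          rw [map_mul, map_mul, map_pow, map_pow, φp, φ1, φ2, Algebra.smul_def, map_mul, map_inv₀,
            map_pow, finProdFinEquiv_apply_val, pow_add, pow_mul, mul_pow, inv_pow]
          ring)
      intro ij
      have h1 := this ij
      rcases mul_eq_zero.1 h1 with h2 | h2
      · exact (map_eq_zero_iff _ (IsFractionRing.injective (Polynomial K) L)).1 h2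
      · exact absurd h2 (inv_ne_zero (pow_ne_zero _ hh0))
    simp [hc]
  exact hinj.isDomain φ

end Domain

instance (n : ℕ) [hn : Fact (IsPrimePow n)] (K : Type*) [Field K] :
    IsDomain (CoordinateRing n K) :=
  coordinateRing_isDomain n K hn.out.two_le

section Curve

variable (n : ℕ) [Fact (IsPrimePow n)] (K : Type*) [Field K]

/-- The function field `K(x, y, z)` of the GK curve. -/
abbrev FunctionField : Type _ := FractionRing (CoordinateRing n K)

/-- The function `x` on the GK curve. -/
noncomputable def x : FunctionField n K := algebraMap (CoordinateRing n K) _ (coord n K 0)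

/-- The function `y` on the GK curve. -/
noncomputable def y : FunctionField n K := algebraMap (CoordinateRing n K) _ (coord n K 1)

/-- The function `z` on the GK curve. -/
noncomputable def z : FunctionField n K := algebraMap (CoordinateRing n K) _ (coord n K 2)

/-- A place of the function field over `K`, given by its normalized discrete valuation: a
valuation (written multiplicatively, so that a zero of order `k` has value `exp (-k)`) which
is trivial on `K` and takes every value. -/
structure Place where
  /-- The normalized valuation of the place. -/
  val : Valuation (FunctionField n K) (WithZero (Multiplicative ℤ))
  trivial_on_constants : ∀ c : K, c ≠ 0 → val (algebraMap K (FunctionField n K) c) = 1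
  surjective : Function.Surjective val

/-- The group of divisors: the free abelian group on the places. -/
abbrev Divisor : Type _ := Place n K →₀ ℤ

variable {n K}

/-- The order of a nonzero function at a place (positive at zeros, negative at poles). -/
noncomputable def Place.ord (P : Place n K) (f : FunctionField n K) : ℤ :=
  -WithZero.log (P.val f)

/-- `D` is the principal divisor `(f)` of the nonzero function `f`. -/
def IsDivisorOf (f : FunctionField n K) (D : Divisor n K) : Prop :=
  f ≠ 0 ∧ ∀ P : Place n K, P.ord f = D P

variable (n)

/-- The local ring of the projective GK curve at its point with homogeneous coordinates
`(v 0 : v 1 : v 2 : v 3)`, where `v 3 = 0` is the plane at infinity: the functions that can be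
written as a quotient `G(x, y, z, 1) / H(x, y, z, 1)` of forms `G`, `H` of the same degree, with
`H(v) ≠ 0`. -/
def localRing (v : Fin 4 → K) : Set (FunctionField n K) :=
  {f | ∃ (d : ℕ) (G H : MvPolynomial (Fin 4) K), G.IsHomogeneous d ∧ H.IsHomogeneous d ∧
    MvPolynomial.eval v H ≠ 0 ∧
    f = MvPolynomial.aeval ![x n K, y n K, z n K, 1] G /
      MvPolynomial.aeval ![x n K, y n K, z n K, 1] H}

variable {n}

/-- `P` is the place of the point with homogeneous coordinates `v`: its valuation ring is the
local ring of the curve at that point. -/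
def Place.IsAt (P : Place n K) (v : Fin 4 → K) : Prop :=
  {f | P.val f ≤ 1} = localRing n v

variable (n K)

/-- The affine `K`-rational points `(a, b, c)` of the GK curve. -/
abbrev AffinePoint : Type _ := {p : K × K × K // OnCurve n p.1 p.2.1 p.2.2}

variable {n K}

/-- The point `(a, 0, 0)`, for a root `a` of `T^n + T`. -/
def AffinePoint.ofRoot (a : {a : K // a ^ n + a = 0}) : AffinePoint n K :=
  ⟨(a.1, 0, 0), by simp [OnCurve, m, a.2]⟩

/-- The origin. -/
def AffinePoint.origin : AffinePoint n K :=
  ⟨(0, 0, 0), by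
    have : n ≠ 0 := (Fact.out : IsPrimePow n).ne_zero
    simp [OnCurve, m, this]⟩

end Curve

end GK

set_option linter.unusedSectionVars false

/-! In characteristic `p`, the Hermitian equation `x^n + x = y^(n+1)` collapses `y h(x)` to `y^(n²)
- y` (`mul_h_eq`). With `m = n² - n + 1`, the curve is therefore given by `z^m = y^(n²) - y` and
`x^n + x = y^(n+1)`, whose left or right sides are additive in `y` and `x` respectively.

Subtract these equations from their values at a rational point `(a, b, c)`. Then `y - b` times a
unit is a multiple of `z - c`, and `x - a` times a unit is a multiple of `y - b`. So `z - c`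
generates the maximal ideal of the local ring. At infinity, with `u = 1/x`, `v = y/x`, `w = z/x`,
the equations become `unit * u = v^(n+1)` and `unit * v = w^m`, so `w` is a uniformizer there. In
both cases `exists_valuation_of_uniformizer` produces the place.

The multiplicities follow: at a common zero, `x` has the order of `y^(n+1)`, `y` that of `z^m`, and
`z` has order 1; at infinity `1/x` has order `(n+1)m = n³+1`.

No other place contributes. A pole of `x` is centred at infinity (`valuation_coordInfty_lt`). Where
`x` is finite, so are `y` and `z`, and a zero of `y` or `z` reduces to a rational point because `T^n
+ T - β` (for `β^n = β`) and `T^(n²) - T` split over `K`. Finally, a place is determined by its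
centre, since it dominates a discrete valuation ring (`valuation_eq_of_le`, `Place.eq_of_center`).
-/

namespace GK

/-! ### Local rings of points and their discrete valuations -/

section PointValuation

variable {K F σ : Type*} [Field K] [Field F] [Algebra K F]

/-- The functions `g(t) / h(t)` with `h(v) ≠ 0`. -/
def pointRing (t : σ → F) (v : σ → K) : Set F :=
  {f | ∃ g h : MvPolynomial σ K, eval v h ≠ 0 ∧ f = aeval t g / aeval t h}

theorem sub_eval_mem_span (v : σ → K) (g : MvPolynomial σ K) :
    g - C (eval v g) ∈ Ideal.span (Set.range fun j => X j - C (v j)) := by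
  induction g using MvPolynomial.induction_on with
  | C a => simp
  | add p q hp hq =>
    have := Ideal.add_mem _ hp hq
    convert this using 1
    simp only [map_add]; ring
  | mul_X p j hp =>
    have h1 := Ideal.mul_mem_right (X j) _ hp
    have h2 := Ideal.mul_mem_left (Ideal.span (Set.range fun j => X j - C (v j)))
      (C (eval v p)) (Ideal.subset_span ⟨j, rfl⟩)
    have := Ideal.add_mem _ h1 h2
    convert this using 1
    simp only [map_mul, eval_X]; ring

/-- The local ring of the point is a localization of `K[t]`, hence Noetherian. Its maximal ideal is
generated by the `t j - v j`, and `hw` makes each of them a multiple of `w` up to a unit. A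
principal nonzero maximal ideal makes the ring a discrete valuation ring, whose valuation is the one
sought. -/
theorem exists_valuation_of_uniformizer [Finite σ] (t : σ → F) (v : σ → K)
    (hev : ∀ g : MvPolynomial σ K, aeval t g = 0 → eval v g = 0)
    (w : MvPolynomial σ K) (hw0 : eval v w = 0) (hw1 : aeval t w ≠ 0)
    (hw : ∀ j, ∃ e a : MvPolynomial σ K, eval v e ≠ 0 ∧
      aeval t e * (t j - algebraMap K F (v j)) = aeval t w * aeval t a)
    (hfrac : ∀ f : F, ∃ g h : MvPolynomial σ K, aeval t h ≠ 0 ∧ f = aeval t g / aeval t h) :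
    ∃ val : Valuation F (WithZero (Multiplicative ℤ)),
      (∀ c : K, c ≠ 0 → val (algebraMap K F c) = 1) ∧ Function.Surjective val ∧
      {f | val f ≤ 1} = pointRing t v ∧ val (aeval t w) = WithZero.exp (-1) ∧
      ∀ j, val (t j - algebraMap K F (v j)) < 1 := by
  let φ : MvPolynomial σ K →+* F := (aeval t).toRingHom
  have hφ : ∀ g, φ g = aeval t g := fun g => rfl
  let A : Subring F := φ.range
  let ψ : MvPolynomial σ K →+* A := φ.rangeRestrict
  have hψ : Function.Surjective ψ := φ.rangeRestrict_surjective
  have hψφ : ∀ g, ((ψ g : A) : F) = aeval t g := fun g => rfl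
  -- Evaluation at `v` descends to `K[t]`, so the functions vanishing at the point form a prime
  -- ideal.
  have hker : RingHom.ker ψ ≤ RingHom.ker (eval v) := fun g hg =>
    hev g (by rw [← hψφ, (RingHom.mem_ker).1 hg]; rfl)
  let P : Ideal A := (RingHom.ker (eval v)).map ψ
  have hkp : (RingHom.ker (eval v)).IsPrime := RingHom.ker_isPrime _
  have hP : P.IsPrime := Ideal.map_isPrime_of_surjective hψ hker
  have hmem : ∀ g, ψ g ∈ P ↔ eval v g = 0 := by
    intro g
    rw [Ideal.mem_map_iff_of_surjective ψ hψ]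
    constructor
    · rintro ⟨g', h1, h2⟩
      have h3 : g' - g ∈ RingHom.ker ψ := by rw [RingHom.mem_ker, map_sub, h2, sub_self]
      have h4 := hker h3
      rw [RingHom.mem_ker, map_sub, (RingHom.mem_ker).1 h1, zero_sub, neg_eq_zero] at h4
      exact h4
    · intro h; exact ⟨g, h, rfl⟩
  have hne : ∀ g, eval v g ≠ 0 → aeval t g ≠ 0 := fun g hg h => hg (hev g h)
  have hA : IsNoetherianRing A := isNoetherianRing_of_surjective _ _ ψ hψ
  let R : Subring F := (LocalSubring.ofPrime A P).toSubring
  have hloc : IsLocalization.AtPrime R P := inferInstanceAs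
    (IsLocalization.AtPrime (LocalSubring.ofPrime A P).toSubring P)
  have hRl : IsLocalRing R := (LocalSubring.ofPrime A P).isLocalRing
  have hRN : IsNoetherianRing R := IsLocalization.isNoetherianRing P.primeCompl R hA
  have halg : ∀ a : A, ((algebraMap A R a : R) : F) = a := fun a => rfl
  have hR : ∀ f : F, f ∈ R ↔ f ∈ pointRing t v := by
    intro f
    constructor
    · intro hf
      obtain ⟨⟨a, s⟩, hs⟩ := IsLocalization.surj P.primeCompl (⟨f, hf⟩ : R)
      obtain ⟨g, rfl⟩ := hψ a
      obtain ⟨s, hsP⟩ := s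
      obtain ⟨h, rfl⟩ := hψ s
      have hh : eval v h ≠ 0 := fun h0 => hsP ((hmem h).2 h0)
      refine ⟨g, h, hh, ?_⟩
      rw [eq_div_iff (hne h hh)]
      exact congrArg Subtype.val hs
    · rintro ⟨g, h, hh, rfl⟩
      have hu : IsUnit (algebraMap A R (ψ h)) :=
        IsLocalization.map_units R (⟨ψ h, fun h0 => hh ((hmem h).1 h0)⟩ : P.primeCompl)
      obtain ⟨b, hb⟩ := hu.exists_right_inv
      have hb' : aeval t h * (b : F) = 1 := congrArg Subtype.val hb
      have : aeval t g / aeval t h = ((algebraMap A R (ψ g) * b : R) : F) := by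
        rw [div_eq_iff (hne h hh)]
        change _ = (aeval t g * (b : F)) * _
        rw [mul_assoc, mul_comm (b : F), hb', mul_one]
      rw [this]; exact Subtype.property _
  have hpoly : ∀ g : MvPolynomial σ K, aeval t g ∈ R := fun g =>
    (hR _).2 ⟨g, 1, by simp, by simp⟩
  let ω : R := ⟨aeval t w, hpoly w⟩
  have hω0 : ω ≠ 0 := fun h0 => hw1 (congrArg Subtype.val h0)
  have hinv : ∀ g : MvPolynomial σ K, eval v g ≠ 0 → (aeval t g)⁻¹ ∈ R := fun g hg =>
    (hR _).2 ⟨1, g, hg, by simp⟩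
  have hωu : ¬ IsUnit ω := by
    intro hu
    obtain ⟨b, hb⟩ := hu.exists_right_inv
    obtain ⟨g, h, hh, hgh⟩ := (hR _).1 b.2
    have hb' : aeval t w * (b : F) = 1 := congrArg Subtype.val hb
    rw [hgh, mul_div_assoc', div_eq_one_iff_eq (hne h hh), ← map_mul, ← sub_eq_zero,
      ← map_sub] at hb'
    have := hev _ hb'
    rw [map_sub, map_mul, hw0, zero_mul, zero_sub, neg_eq_zero] at this
    exact hh this
  have hspan : ∀ g : MvPolynomial σ K, eval v g = 0 →
      (⟨aeval t g, hpoly g⟩ : R) ∈ Ideal.span {ω} := by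
    intro g hg
    have h1 := sub_eval_mem_span v g
    rw [hg, map_zero, sub_zero] at h1
    let χ : MvPolynomial σ K →+* R := φ.codRestrict R hpoly
    have h2 : Ideal.span (Set.range fun j => X j - C (v j)) ≤ (Ideal.span {ω}).comap χ := by
      rw [Ideal.span_le]
      rintro _ ⟨j, rfl⟩
      obtain ⟨e, a, he, hea⟩ := hw j
      rw [SetLike.mem_coe, Ideal.mem_comap, Ideal.mem_span_singleton]
      refine ⟨χ a * ⟨_, hinv e he⟩, Subtype.ext ?_⟩
      change aeval t (X j - C (v j)) = aeval t w * (aeval t a * (aeval t e)⁻¹)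
      rw [← mul_assoc, ← hea, mul_right_comm, mul_inv_cancel₀ (hne e he), one_mul]
      simp
    exact h2 h1
  have hmax : IsLocalRing.maximalIdeal R = Ideal.span {ω} := by
    apply le_antisymm
    · intro r hr
      obtain ⟨g, h, hh, hgh⟩ := (hR _).1 r.2
      by_cases hg : eval v g = 0
      · have : r = ⟨aeval t g, hpoly g⟩ * ⟨_, hinv h hh⟩ := Subtype.ext (by
          rw [hgh, div_eq_mul_inv]; rfl)
        rw [this]
        exact Ideal.mul_mem_right _ _ (hspan g hg)
      · refine absurd ?_ ((IsLocalRing.mem_maximalIdeal r).1 hr)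
        refine IsUnit.of_mul_eq_one (⟨aeval t h, hpoly h⟩ * ⟨_, hinv g hg⟩) (Subtype.ext ?_)
        change (r : F) * (aeval t h * (aeval t g)⁻¹) = 1
        rw [hgh]
        have := hne g hg
        have := hne h hh
        field_simp
    · rw [Ideal.span_singleton_le_iff_mem]
      exact (IsLocalRing.mem_maximalIdeal _).2 hωu
  have hnf : ¬ IsField R := by
    rw [IsLocalRing.isField_iff_maximalIdeal_eq, hmax, Ideal.span_singleton_eq_bot]
    exact hω0
  -- Entries 0 and 4 of the list are "discrete valuation ring" and "principal maximal ideal".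
  have hdvr : IsDiscreteValuationRing R := by
    refine ((IsDiscreteValuationRing.TFAE R hnf).out 0 4).2 ?_
    exact ⟨⟨ω, hmax⟩⟩
  have hfr : IsFractionRing R F := by
    refine IsFractionRing.of_field R F fun f => ?_
    obtain ⟨g, h, hh, rfl⟩ := hfrac f
    exact ⟨⟨_, hpoly g⟩, ⟨_, hpoly h⟩, rfl⟩
  let 𝔭 : IsDedekindDomain.HeightOneSpectrum R := IsDiscreteValuationRing.maximalIdeal R
  have h𝔭 : 𝔭.asIdeal = Ideal.span {ω} := hmax
  have hset : {f | 𝔭.valuation F f ≤ 1} = pointRing t v := by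
    ext f
    rw [← hR]
    constructor
    · intro hf
      obtain ⟨r, rfl⟩ := IsDedekindDomain.HeightOneSpectrum.mem_integers_of_valuation_le_one F f (fun 𝔮 => by
        have : 𝔮 = 𝔭 := IsDedekindDomain.HeightOneSpectrum.ext
          (IsLocalRing.eq_maximalIdeal (𝔮.isPrime.isMaximal 𝔮.ne_bot))
        rw [this]; exact hf)
      exact r.2
    · intro hf
      exact 𝔭.valuation_le_one (K := F) (⟨f, hf⟩ : R)
  have hle : ∀ f ∈ pointRing t v, 𝔭.valuation F f ≤ 1 := fun f hf => by rw [← hset] at hf; exact hf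
  have hone : ∀ f, f ≠ 0 → f ∈ pointRing t v → f⁻¹ ∈ pointRing t v → 𝔭.valuation F f = 1 := by
    intro f hf0 hf hf'
    refine le_antisymm (hle f hf) ?_
    have := hle _ hf'
    rw [map_inv₀] at this
    exact (inv_le_one₀ (zero_lt_iff.2 ((Valuation.ne_zero_iff _).2 hf0))).1 this
  have hwval : 𝔭.valuation F (aeval t w) = WithZero.exp (-1) := by
    have := 𝔭.valuation_of_algebraMap (K := F) ω
    rw [𝔭.intValuation_singleton hω0 h𝔭] at this
    exact this
  refine ⟨𝔭.valuation F, ?_, 𝔭.valuation_surjective F, hset, hwval, fun j => ?_⟩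
  · intro c hc
    exact hone _ ((map_ne_zero _).2 hc) ⟨C c, 1, by simp, by simp⟩ ⟨C c⁻¹, 1, by simp, by simp⟩
  · obtain ⟨e, a, he, hea⟩ := hw j
    have := congrArg (𝔭.valuation F) hea
    rw [map_mul, map_mul, hone _ (hne e he) ⟨e, 1, by simp, by simp⟩ ⟨1, e, he, by simp⟩,
      one_mul] at this
    rw [this]
    refine (mul_le_of_le_one_right' (hle _ ⟨a, 1, by simp, by simp⟩)).trans_lt ?_
    rw [hwval, ← WithZero.exp_zero, WithZero.exp_lt_exp]; norm_num

theorem valuation_aeval_sub_lt {Γ : Type*} [LinearOrderedCommGroupWithZero Γ]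
    (val : Valuation F Γ) (hK : ∀ c : K, c ≠ 0 → val (algebraMap K F c) = 1)
    (t : σ → F) (v : σ → K) (ht : ∀ j, val (t j - algebraMap K F (v j)) < 1)
    (g : MvPolynomial σ K) : val (aeval t g - algebraMap K F (eval v g)) < 1 := by
  have hK' : ∀ c : K, val (algebraMap K F c) ≤ 1 := fun c => by
    by_cases hc : c = 0
    · simp [hc]
    · exact (hK c hc).le
  have ht' : ∀ j, val (t j) ≤ 1 := fun j => by
    have := val.map_add (t j - algebraMap K F (v j)) (algebraMap K F (v j))
    rw [sub_add_cancel] at this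
    exact this.trans (max_le (ht j).le (hK' _))
  induction g using MvPolynomial.induction_on with
  | C a => simp
  | add p q hp hq =>
    have : aeval t (p + q) - algebraMap K F (eval v (p + q)) =
      (aeval t p - algebraMap K F (eval v p)) + (aeval t q - algebraMap K F (eval v q)) := by
      simp only [map_add]; ring
    rw [this]
    exact val.map_add_lt hp hq
  | mul_X p j hp =>
    have : aeval t (p * X j) - algebraMap K F (eval v (p * X j)) =
      (aeval t p - algebraMap K F (eval v p)) * t j
        + algebraMap K F (eval v p) * (t j - algebraMap K F (v j)) := by
      simp only [map_mul, aeval_X, eval_X]; ring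
    rw [this]
    refine val.map_add_lt ?_ ?_
    · rw [map_mul]; exact (mul_le_of_le_one_right' (ht' j)).trans_lt hp
    · rw [map_mul]; exact (mul_le_of_le_one_left' (hK' _)).trans_lt (ht j)

/-- A relation among the `t j` not satisfied at `v` would give a nonzero constant of value less than
1. So any valuation centred at `v`, discrete or not, shows that `v` satisfies all the relations. -/
theorem eval_eq_zero_of_valuation {Γ : Type*} [LinearOrderedCommGroupWithZero Γ]
    (val : Valuation F Γ) (hK : ∀ c : K, c ≠ 0 → val (algebraMap K F c) = 1)
    (t : σ → F) (v : σ → K) (ht : ∀ j, val (t j - algebraMap K F (v j)) < 1)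
    (g : MvPolynomial σ K) (hg : aeval t g = 0) : eval v g = 0 := by
  by_contra h0
  have := valuation_aeval_sub_lt val hK t v ht g
  rw [hg, zero_sub, Valuation.map_neg, hK _ h0] at this
  exact lt_irrefl _ this

theorem valuation_le_one_of_mem_pointRing {Γ : Type*} [LinearOrderedCommGroupWithZero Γ]
    (val : Valuation F Γ) (hK : ∀ c : K, c ≠ 0 → val (algebraMap K F c) = 1)
    (t : σ → F) (v : σ → K) (ht : ∀ j, val (t j - algebraMap K F (v j)) < 1)
    (f : F) (hf : f ∈ pointRing t v) : val f ≤ 1 := by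
  obtain ⟨g, h, hh, rfl⟩ := hf
  have key := valuation_aeval_sub_lt val hK t v ht
  have h1 : val (aeval t h) = 1 := by
    have := Valuation.map_add_eq_of_lt_right val (x := aeval t h - algebraMap K F (eval v h))
      (y := algebraMap K F (eval v h)) (by rw [hK _ hh]; exact key h)
    rw [sub_add_cancel, hK _ hh] at this
    exact this
  have h2 : val (aeval t g) ≤ 1 := by
    have := val.map_add (aeval t g - algebraMap K F (eval v g)) (algebraMap K F (eval v g))
    rw [sub_add_cancel] at this
    refine this.trans (max_le (key g).le ?_)
    by_cases hc : eval v g = 0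
    · simp [hc]
    · exact (hK _ hc).le
  rw [map_div₀, h1, div_one]
  exact h2

/-- A normalized discrete valuation is determined by its valuation ring, even by an inclusion. -/
theorem valuation_eq_of_le (v₁ v₂ : Valuation F (WithZero (Multiplicative ℤ)))
    (h₁ : Function.Surjective v₁) (h₂ : Function.Surjective v₂)
    (h : ∀ f, v₁ f ≤ 1 → v₂ f ≤ 1) : v₁ = v₂ := by
  have hone : ∀ f, v₁ f = 1 → v₂ f = 1 := by
    intro f hf
    have hf0 : f ≠ 0 := by rintro rfl; simp at hf
    refine le_antisymm (h f hf.le) ?_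
    have := h f⁻¹ (by rw [map_inv₀, hf, inv_one])
    rw [map_inv₀] at this
    exact (inv_le_one₀ (zero_lt_iff.2 (v₂.ne_zero_iff.2 hf0))).1 this
  obtain ⟨π, hπ⟩ := h₁ (WithZero.exp (-1))
  have hπ0 : π ≠ 0 := by rintro rfl; rw [map_zero] at hπ; exact WithZero.exp_ne_zero hπ.symm
  -- Each `f` is a power of `π` times a `v₁`-unit, which is also a `v₂`-unit.
  have hexp : ∀ f, f ≠ 0 → ∃ k : ℤ, v₁ f = WithZero.exp (-1) ^ k ∧ v₂ f = v₂ π ^ k := by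
    intro f hf
    have hf1 : v₁ f ≠ 0 := v₁.ne_zero_iff.2 hf
    refine ⟨-WithZero.log (v₁ f), ?_, ?_⟩
    · rw [← WithZero.exp_zsmul, smul_eq_mul, mul_neg_one, neg_neg, WithZero.exp_log hf1]
    · have := hone (f / π ^ (-WithZero.log (v₁ f))) (by
        rw [map_div₀, map_zpow₀, hπ, ← WithZero.exp_zsmul, smul_eq_mul, mul_neg_one, neg_neg,
          WithZero.exp_log hf1, div_self hf1])
      rw [map_div₀, map_zpow₀, div_eq_one_iff_eq (zpow_ne_zero _ (v₂.ne_zero_iff.2 hπ0))] at this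
      exact this
  have hπ2 : v₂ π ≤ 1 := h π (by rw [hπ, ← WithZero.exp_zero, WithZero.exp_le_exp]; norm_num)
  have hπ3 : v₂ π = WithZero.exp (-1) := by
    obtain ⟨f, hf⟩ := h₂ (WithZero.exp (-1))
    have hf0 : f ≠ 0 := by rintro rfl; rw [map_zero] at hf; exact WithZero.exp_ne_zero hf.symm
    obtain ⟨k, -, hk⟩ := hexp f hf0
    have hne : v₂ π ≠ 0 := v₂.ne_zero_iff.2 hπ0
    rw [← WithZero.exp_log hne] at hk hπ2 ⊢
    rw [hf, ← WithZero.exp_zsmul, WithZero.exp_inj, smul_eq_mul] at hk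
    rw [← WithZero.exp_zero, WithZero.exp_le_exp] at hπ2
    rw [WithZero.exp_inj]
    -- Surjectivity of `v₂` makes `-1` a multiple of this logarithm, which is also at most 0; hence
    -- it is `-1`.
    have : WithZero.log (v₂ π) ∣ 1 := ⟨-k, by linarith⟩
    rcases Int.isUnit_iff.1 (isUnit_of_dvd_one this) with h | h <;> omega
  ext f
  by_cases hf : f = 0
  · simp [hf]
  · obtain ⟨k, h1, h2⟩ := hexp f hf
    rw [h1, h2, hπ3]

end PointValuation
-- Quotients of forms and affine charts
section Homogenization

variable {K F σ : Type*} [Field K] [Field F] [Algebra K F]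

/-- Monomials can be padded with powers of `X i₀`, which changes neither value. All large degrees
are allowed so that two polynomials can be given the same degree. -/
theorem exists_homogeneous (t : σ → F) (v : σ → K) (i₀ : σ) (ht : t i₀ = 1) (hv : v i₀ = 1)
    (g : MvPolynomial σ K) : ∃ N, ∀ d ≥ N, ∃ G : MvPolynomial σ K, G.IsHomogeneous d ∧
      aeval t G = aeval t g ∧ eval v G = eval v g := by
  induction g using MvPolynomial.induction_on with
  | C a =>
    refine ⟨0, fun d _ => ⟨C a * X i₀ ^ d, ?_, by simp [ht], by simp [hv]⟩⟩
    have := (isHomogeneous_C σ a).mul (isHomogeneous_X_pow i₀ d)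
    rwa [zero_add] at this
  | add p q hp hq =>
    obtain ⟨N₁, h₁⟩ := hp
    obtain ⟨N₂, h₂⟩ := hq
    refine ⟨max N₁ N₂, fun d hd => ?_⟩
    obtain ⟨G₁, a₁, b₁, c₁⟩ := h₁ d (le_of_max_le_left hd)
    obtain ⟨G₂, a₂, b₂, c₂⟩ := h₂ d (le_of_max_le_right hd)
    exact ⟨G₁ + G₂, a₁.add a₂, by simp [b₁, b₂], by simp [c₁, c₂]⟩
  | mul_X p j hp =>
    obtain ⟨N, h⟩ := hp
    refine ⟨N + 1, fun d hd => ?_⟩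
    obtain ⟨G, a, b, c⟩ := h (d - 1) (by omega)
    refine ⟨G * X j, ?_, by simp [b], by simp [c]⟩
    have := a.mul (isHomogeneous_X K j)
    rwa [show d - 1 + 1 = d by omega] at this

theorem aeval_mul_of_isHomogeneous (c : F) (t : σ → F) {d : ℕ} {G : MvPolynomial σ K}
    (hG : G.IsHomogeneous d) : aeval (fun j => c * t j) G = c ^ d * aeval t G := by
  simp only [aeval_def, eval₂_eq, Finset.mul_sum]
  refine Finset.sum_congr rfl fun e he => ?_
  have h1 := hG (mem_support_iff.1 he)
  rw [Finsupp.weight_apply, Finsupp.sum] at h1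
  simp only [Pi.one_apply, smul_eq_mul, mul_one] at h1
  simp only [mul_pow, Finset.prod_mul_distrib, Finset.prod_pow_eq_pow_sum, h1]
  ring

/-- Rescaling the coordinates by `c` cancels in a quotient of forms of equal degree. The factor is 1
for affine points and `x` at infinity. -/
theorem homogeneous_quotients_eq_pointRing (c : F) (hc : c ≠ 0) (t : σ → F) (v : σ → K) (i₀ : σ)
    (ht : t i₀ = 1) (hv : v i₀ = 1) :
    {f | ∃ (d : ℕ) (G H : MvPolynomial σ K), G.IsHomogeneous d ∧ H.IsHomogeneous d ∧
      eval v H ≠ 0 ∧ f = aeval (fun j => c * t j) G / aeval (fun j => c * t j) H}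
      = pointRing t v := by
  ext f
  constructor
  · rintro ⟨d, G, H, hG, hH, h0, rfl⟩
    refine ⟨G, H, h0, ?_⟩
    rw [aeval_mul_of_isHomogeneous c t hG, aeval_mul_of_isHomogeneous c t hH,
      mul_div_mul_left _ _ (pow_ne_zero _ hc)]
  · rintro ⟨g, h, h0, rfl⟩
    obtain ⟨N₁, h₁⟩ := exists_homogeneous t v i₀ ht hv g
    obtain ⟨N₂, h₂⟩ := exists_homogeneous t v i₀ ht hv h
    obtain ⟨G, a₁, b₁, c₁⟩ := h₁ (max N₁ N₂) (le_max_left _ _)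
    obtain ⟨H, a₂, b₂, c₂⟩ := h₂ (max N₁ N₂) (le_max_right _ _)
    refine ⟨_, G, H, a₁, a₂, by rwa [c₂], ?_⟩
    rw [aeval_mul_of_isHomogeneous c t a₁, aeval_mul_of_isHomogeneous c t a₂,
      mul_div_mul_left _ _ (pow_ne_zero _ hc), b₁, b₂]

theorem exists_quotient (c : F) (hc : c ≠ 0) (t : σ → F) (i₁ : σ) (hs : c * t i₁ = 1)
    (g h : MvPolynomial σ K) (hh : aeval (fun j => c * t j) h ≠ 0) :
    ∃ G H : MvPolynomial σ K, aeval t H ≠ 0 ∧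
      aeval (fun j => c * t j) g / aeval (fun j => c * t j) h = aeval t G / aeval t H := by
  obtain ⟨N₁, h₁⟩ := exists_homogeneous (fun j => c * t j) (fun _ => (1 : K)) i₁ hs rfl g
  obtain ⟨N₂, h₂⟩ := exists_homogeneous (fun j => c * t j) (fun _ => (1 : K)) i₁ hs rfl h
  obtain ⟨G, a₁, b₁, -⟩ := h₁ (max N₁ N₂) (le_max_left _ _)
  obtain ⟨H, a₂, b₂, -⟩ := h₂ (max N₁ N₂) (le_max_right _ _)
  rw [← b₂, aeval_mul_of_isHomogeneous c t a₂] at hh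
  refine ⟨G, H, right_ne_zero_of_mul hh, ?_⟩
  rw [← b₁, ← b₂, aeval_mul_of_isHomogeneous c t a₁, aeval_mul_of_isHomogeneous c t a₂,
      mul_div_mul_left _ _ (pow_ne_zero _ hc)]

end Homogenization
-- Additivity of `n`-th powers and the simplified equations
section Frobenius

variable {R : Type*} [CommRing R] {p n k : ℕ} [CharP R p]

theorem add_pow_of_charP [Fact p.Prime] (hn : n = p ^ k) (a b : R) :
    (a + b) ^ n = a ^ n + b ^ n := by
  subst hn; exact add_pow_char_pow a b p k

theorem neg_one_pow_of_charP [Fact p.Prime] (hn : n = p ^ k) : (-1 : R) ^ n = -1 := by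
  have h := add_pow_of_charP (R := R) hn (-1) 1
  have : n ≠ 0 := hn ▸ pow_ne_zero _ (Fact.out : p.Prime).ne_zero
  rw [neg_add_cancel, zero_pow this, one_pow] at h
  linear_combination -h

theorem sub_pow_of_charP [Fact p.Prime] (hn : n = p ^ k) (a b : R) :
    (a - b) ^ n = a ^ n - b ^ n := by
  rw [sub_eq_add_neg, add_pow_of_charP hn, neg_pow, neg_one_pow_of_charP hn]; ring

/-- Up to sign, `h n a` is the geometric sum in `-a^(n-1)` with `n + 1` terms; `(-1)^n = -1` also
holds for `p = 2`. -/
theorem h_mul [Fact p.Prime] (hn : n = p ^ k) (a : R) :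
    h n a * (a ^ n + a) = a ^ n ^ 2 - a := by
  have hn0 : n ≠ 0 := hn ▸ pow_ne_zero _ (Fact.out : p.Prime).ne_zero
  obtain ⟨l, rfl⟩ : ∃ l, n = l + 1 := ⟨n - 1, by omega⟩
  have h1 : h (l + 1) a = -∑ i ∈ Finset.range (l + 1 + 1), (-a ^ l) ^ i := by
    unfold h
    rw [← Finset.sum_neg_distrib]
    refine Finset.sum_congr rfl fun i _ => ?_
    rw [Nat.add_sub_cancel, neg_pow (a ^ l) i, ← pow_mul, mul_comm i l]; ring
  have h2 := geom_sum_mul (-a ^ l) (l + 1 + 1)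
  have h3 : (-a ^ l) ^ (l + 1 + 1) = a ^ (l * (l + 2)) := by
    rw [neg_pow, pow_succ, neg_one_pow_of_charP hn, ← pow_mul]; ring
  have h4 : a ^ (l + 1) ^ 2 = a ^ (l * (l + 2)) * a := by rw [← pow_succ]; congr 1; ring
  rw [h1, h4, ← h3]
  linear_combination a * h2

/-- The Hermitian curve equation gives `y h(x) = y^{n²} - y`. -/
theorem mul_h_eq [IsDomain R] [Fact p.Prime] (hn : n = p ^ k) {a b : R}
    (hab : a ^ n + a = b ^ (n + 1)) : b * h n a = b ^ n ^ 2 - b := by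
  have hn0 : n ≠ 0 := hn ▸ pow_ne_zero _ (Fact.out : p.Prime).ne_zero
  -- For `b ≠ 0`, the `n`-th power of the Hermitian equation eliminates `a^(n²)` from `h_mul`,
  -- leaving the claim multiplied by `b^n`.
  rcases eq_or_ne b 0 with rfl | hb
  · simp [hn0]
  · have h1 := h_mul hn a
    have h2 : (a ^ n + a) ^ n = a ^ n ^ 2 + a ^ n := by
      rw [add_pow_of_charP hn, ← pow_mul, sq]
    rw [hab] at h1 h2
    have h3 : b ^ n * (b * h n a) = b ^ n * (b ^ n ^ 2 - b) := by
      linear_combination h1 - h2 - hab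
    exact mul_left_cancel₀ (pow_ne_zero _ hb) h3

theorem onCurve_iff [IsDomain R] [Fact p.Prime] (hn : n = p ^ k) {a b c : R} :
    OnCurve n a b c ↔ c ^ m n = b ^ n ^ 2 - b ∧ a ^ n + a = b ^ (n + 1) := by
  constructor
  · rintro ⟨h1, h2⟩; exact ⟨h1.trans (mul_h_eq hn h2), h2⟩
  · rintro ⟨h1, h2⟩; exact ⟨h1.trans (mul_h_eq hn h2).symm, h2⟩

theorem onCurve_zero_iff [IsDomain R] [Fact p.Prime] (hn : n = p ^ k) (a b : R) :
    OnCurve n a b 0 ↔ a ^ n ^ 2 = a ∧ b ^ n ^ 2 = b ∧ a ^ n + a = b ^ (n + 1) := by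
  rw [onCurve_iff hn, zero_pow (Nat.succ_ne_zero _), eq_comm, sub_eq_zero]
  constructor
  · rintro ⟨h1, h2⟩
    refine ⟨?_, h1, h2⟩
    have h3 : (a ^ n + a) ^ n = a ^ n ^ 2 + a ^ n := by
      rw [add_pow_of_charP hn, ← pow_mul, sq]
    have h4 : (b ^ (n + 1)) ^ n = b ^ n ^ 2 * b ^ n := by ring
    rw [h2, h4, h1] at h3
    linear_combination -h2 - h3
  · rintro ⟨-, h1, h2⟩; exact ⟨h1, h2⟩

end Frobenius

/-! ### Splitting over `K` and counting points -/

section FiniteField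

variable {K : Type*} [Field K]

theorem exists_charP_of_card {n : ℕ} [Fintype K] (hn : IsPrimePow n) (hK : Fintype.card K = (n ^ 3) ^ 2) :
    ∃ p k : ℕ, Fact p.Prime ∧ CharP K p ∧ n = p ^ k := by
  obtain ⟨p, k, hp, hk, rfl⟩ := (isPrimePow_nat_iff _).1 hn
  refine ⟨p, k, ⟨hp⟩, ?_, rfl⟩
  obtain ⟨p', hp', r, h⟩ := FiniteField.card' K
  have hpp : p ∣ p' ^ (r : ℕ) := by
    rw [← h.2, hK, ← pow_mul, ← pow_mul]
    exact dvd_pow_self _ (by positivity)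
  have := (Nat.prime_dvd_prime_iff_eq hp h.1).1 (hp.dvd_of_dvd_pow hpp)
  rwa [this]

/-- Every element of `K` is a simple root of `X^|K| - X`; divisors inherit splitting and simplicity
of roots. -/
theorem splits_and_card_roots [Fintype K] {f : Polynomial K}
    (hf : f ∣ Polynomial.X ^ Fintype.card K - Polynomial.X) :
    f.Splits ∧ Nat.card {a : K // f.eval a = 0} = f.natDegree := by
  classical
  have h1 := FiniteField.roots_X_pow_card_sub_X K
  have h0 : (Polynomial.X ^ Fintype.card K - Polynomial.X : Polynomial K) ≠ 0 :=
    FiniteField.X_pow_card_sub_X_ne_zero K Fintype.one_lt_card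
  have hs : (Polynomial.X ^ Fintype.card K - Polynomial.X : Polynomial K).Splits := by
    rw [Polynomial.splits_iff_card_roots, h1,
      FiniteField.X_pow_card_sub_X_natDegree_eq K Fintype.one_lt_card]
    rfl
  have hfs := hs.of_dvd h0 hf
  have hf0 : f ≠ 0 := ne_zero_of_dvd_ne_zero h0 hf
  refine ⟨hfs, ?_⟩
  have hnd : f.roots.Nodup := by
    refine Multiset.nodup_of_le (Polynomial.roots.le_of_dvd h0 hf) ?_
    rw [h1]; exact Finset.nodup _
  rw [← Polynomial.splits_iff_card_roots.1 hfs, ← Multiset.toFinset_card_of_nodup hnd,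
    Nat.card_eq_fintype_card, Fintype.card_subtype]
  congr 1
  ext a
  simp [hf0]

variable {n : ℕ}

/-- This is the inclusion of the field with `n²` elements in `K`; it comes from `n² - 1 ∣ n⁶ - 1`.
-/
theorem X_pow_sq_sub_X_dvd [Fintype K] (hn : 2 ≤ n) (hK : Fintype.card K = (n ^ 3) ^ 2) :
    (Polynomial.X ^ n ^ 2 - Polynomial.X : Polynomial K) ∣
      Polynomial.X ^ Fintype.card K - Polynomial.X := by
  have h1 : n ^ 2 - 1 ∣ (n ^ 3) ^ 2 - 1 := by
    have := Nat.sub_dvd_pow_sub_pow (n ^ 2) 1 3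
    rwa [one_pow, show (n ^ 2) ^ 3 = (n ^ 3) ^ 2 by ring] at this
  obtain ⟨e, he⟩ := h1
  have h2 : 1 ≤ n ^ 2 := Nat.one_le_pow _ _ (by omega)
  have h3 : 1 ≤ (n ^ 3) ^ 2 := Nat.one_le_pow _ _ (by positivity)
  have h4 : (Polynomial.X ^ n ^ 2 - Polynomial.X : Polynomial K)
      = Polynomial.X * (Polynomial.X ^ (n ^ 2 - 1) - 1) := by
    rw [mul_sub, ← pow_succ', Nat.sub_add_cancel h2, mul_one]
  have h5 : (Polynomial.X ^ Fintype.card K - Polynomial.X : Polynomial K)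
      = Polynomial.X * ((Polynomial.X ^ (n ^ 2 - 1)) ^ e - 1) := by
    rw [← pow_mul, ← he, mul_sub, ← pow_succ', Nat.sub_add_cancel h3, mul_one, hK]
  rw [h4, h5]
  refine mul_dvd_mul_left _ ?_
  simpa using sub_dvd_pow_sub_pow (Polynomial.X ^ (n ^ 2 - 1) : Polynomial K) 1 e

/-- For `f = X^n + X - β`, additivity gives `f^n - f = X^(n²) - X`. -/
theorem trace_poly_dvd {p k : ℕ} [Fact p.Prime] [CharP K p] (hn : n = p ^ k) {β : K}
    (hβ : β ^ n = β) :
    (Polynomial.X ^ n + Polynomial.X - Polynomial.C β : Polynomial K) ∣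
      Polynomial.X ^ n ^ 2 - Polynomial.X := by
  have hn0 : n ≠ 0 := hn ▸ pow_ne_zero _ (Fact.out : p.Prime).ne_zero
  have : (Polynomial.X ^ n ^ 2 - Polynomial.X : Polynomial K)
      = (Polynomial.X ^ n + Polynomial.X - Polynomial.C β) ^ n
        - (Polynomial.X ^ n + Polynomial.X - Polynomial.C β) := by
    rw [sub_pow_of_charP hn, add_pow_of_charP hn, ← Polynomial.C_pow, hβ, ← pow_mul, sq]
    ring
  rw [this]
  exact dvd_sub (dvd_pow_self _ hn0) dvd_rfl

theorem trace_poly_splits_and_card [Fintype K] {p k : ℕ} [Fact p.Prime] [CharP K p] (hn : n = p ^ k)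
    (hn2 : 2 ≤ n) (hK : Fintype.card K = (n ^ 3) ^ 2) {β : K} (hβ : β ^ n = β) :
    (Polynomial.X ^ n + Polynomial.X - Polynomial.C β : Polynomial K).Splits ∧
      Nat.card {a : K // a ^ n + a = β} = n := by
  have h1 := splits_and_card_roots ((trace_poly_dvd hn hβ).trans (X_pow_sq_sub_X_dvd hn2 hK))
  refine ⟨h1.1, ?_⟩
  have h2 : (Polynomial.X ^ n + Polynomial.X - Polynomial.C β : Polynomial K).natDegree = n := by
    rw [Polynomial.natDegree_sub_C, Polynomial.natDegree_add_eq_left_of_natDegree_lt] <;>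
      simp; omega
  rw [h2] at h1
  refine (Nat.card_congr (Equiv.subtypeEquivRight fun a => ?_)).trans h1.2
  simp [sub_eq_zero]

theorem X_pow_sq_sub_X_splits_and_card [Fintype K] (hn : 2 ≤ n) (hK : Fintype.card K = (n ^ 3) ^ 2) :
    (Polynomial.X ^ n ^ 2 - Polynomial.X : Polynomial K).Splits ∧
      Nat.card {b : K // b ^ n ^ 2 = b} = n ^ 2 := by
  have h1 := splits_and_card_roots (X_pow_sq_sub_X_dvd hn hK)
  refine ⟨h1.1, ?_⟩
  rw [FiniteField.X_pow_card_sub_X_natDegree_eq K (Nat.one_lt_pow two_ne_zero hn)] at h1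
  refine (Nat.card_congr (Equiv.subtypeEquivRight fun a => ?_)).trans h1.2
  simp [sub_eq_zero]

theorem norm_pow_eq {b : K} (hb : b ^ n ^ 2 = b) : (b ^ (n + 1)) ^ n = b ^ (n + 1) := by
  rw [← pow_mul, show (n + 1) * n = n ^ 2 + n by ring, pow_add, hb, ← pow_succ']

/-- Fibre over `b`: there are `n²` values of `b`, and above each one the trace equation with right
side `b^(n+1)` has `n` solutions. -/
theorem card_affinePoint_zero [Fintype K] [Fact (IsPrimePow n)] {p k : ℕ} [Fact p.Prime] [CharP K p]
    (hn : n = p ^ k) (hn2 : 2 ≤ n) (hK : Fintype.card K = (n ^ 3) ^ 2) :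
    Nat.card {P : AffinePoint n K // P.1.2.2 = 0} = n ^ 3 := by
  let e : {P : AffinePoint n K // P.1.2.2 = 0} ≃
      (Σ b : {b : K // b ^ n ^ 2 = b}, {a : K // a ^ n + a = b.1 ^ (n + 1)}) :=
    { toFun := fun P =>
        have h := (onCurve_zero_iff hn P.1.1.1 P.1.1.2.1).1 (by
          have := P.1.2; rwa [P.2] at this)
        ⟨⟨P.1.1.2.1, h.2.1⟩, ⟨P.1.1.1, h.2.2⟩⟩
      invFun := fun s => ⟨⟨(s.2.1, s.1.1, 0), by
        rw [onCurve_iff hn]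
        exact ⟨by simp [s.1.2, m], s.2.2⟩⟩, rfl⟩
      left_inv := by
        rintro ⟨⟨⟨a, b, c⟩, h⟩, hc⟩
        simp only at hc
        subst hc; rfl
      right_inv := by rintro ⟨⟨b, hb⟩, ⟨a, ha⟩⟩; rfl }
  classical
  rw [Nat.card_congr e, Nat.card_sigma]
  have : ∀ b : {b : K // b ^ n ^ 2 = b}, Nat.card {a : K // a ^ n + a = b.1 ^ (n + 1)} = n :=
    fun b => (trace_poly_splits_and_card hn hn2 hK (norm_pow_eq b.2)).2
  simp only [this, Finset.sum_const, Finset.card_univ, smul_eq_mul]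
  rw [← Nat.card_eq_fintype_card, (X_pow_sq_sub_X_splits_and_card hn2 hK).2]
  ring

/-- If a split polynomial takes a value of positive valuation, then the argument is congruent to
a root. -/
theorem exists_root_of_splits {F Γ : Type*} [Field F] [Algebra K F]
    [LinearOrderedCommGroupWithZero Γ] (val : Valuation F Γ)
    {f : Polynomial K} (hf : f.Splits)
    (hm : f.Monic) {s : F} (hs : val (Polynomial.aeval s f) < 1) :
    ∃ a : K, f.eval a = 0 ∧ val (s - algebraMap K F a) < 1 := by
  by_contra! hcon
  rw [hf.eq_prod_roots_of_monic hm, map_multiset_prod, Multiset.map_map, map_multiset_prod,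
    Multiset.map_map] at hs
  refine absurd hs (not_lt.2 ?_)
  refine Multiset.one_le_prod fun x hx => ?_
  obtain ⟨a, ha, rfl⟩ := Multiset.mem_map.1 hx
  have := hcon a (Polynomial.isRoot_of_mem_roots ha)
  simpa using this

end FiniteField

/-! ### Local rings of the curve and places at affine points -/

section Places

theorem OnCurve.map {n : ℕ} {R S : Type*} [CommRing R] [CommRing S] (f : R →+* S) {a b c : R}
    (hc : OnCurve n a b c) : OnCurve n (f a) (f b) (f c) := by
  obtain ⟨h1, h2⟩ := hc
  constructor
  · rw [← map_h, ← map_pow, ← map_mul, h1]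
  · rw [← map_pow, ← map_pow, ← map_add, h2]

/-- Here `n = l + 1`, and `n²` exceeds `l² + l + 1` by `l`. Dividing the second equation by `x^(n²)`
leaves a factor `u^l` beside the power of `w`. Multiplication by `(1 + u^l)^l` turns it into
`v^(l(l+2))` by the first relation, and this cancels. -/
theorem inverted_relations {F : Type*} [Field F] (l : ℕ) {x y z : F} (hx : x ≠ 0) (hy : y ≠ 0)
    (hyF : x ^ (l + 1) + x = y ^ (l + 1 + 1))
    (hzF : z ^ (l ^ 2 + l + 1) = y ^ (l + 1) ^ 2 - y) :
    (1 + (1 / x) ^ l) * (1 / x) = (y / x) ^ (l + 1 + 1) ∧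
    ((1 + (1 / x) ^ l) ^ l - (1 / x) ^ (l * (l + 1))) * (y / x)
      = (z / x) ^ (l ^ 2 + l + 1) := by
  rw [show (l + 1) ^ 2 = (l ^ 2 + l + 1) + l by ring] at hzF
  have hux : 1 / x * x = 1 := one_div_mul_cancel hx
  rw [div_eq_mul_one_div (y), div_eq_mul_one_div (z)]
  have hu0 : 1 / x ≠ 0 := one_div_ne_zero hx
  generalize 1 / x = u at *
  have h1 : (1 + u ^ l) * u = (y * u) ^ (l + 1 + 1) := by
    have e1 : u ^ (l + 1) * x ^ (l + 1) = 1 := by rw [← mul_pow, hux, one_pow]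
    have : (y * u) ^ (l + 1 + 1) = u ^ (l + 1) * u * (x ^ (l + 1) + x) := by
      rw [hyF]; ring
    rw [this]
    linear_combination (-u) * e1 - u ^ (l + 1) * hux
  refine ⟨h1, ?_⟩
  have hv0 : (y * u) ^ (l * (l + 2)) ≠ 0 := pow_ne_zero _ (mul_ne_zero hy hu0)
  apply mul_left_cancel₀ hv0
  have h2 : ((1 + u ^ l) * u) ^ l = (y * u) ^ (l * (l + 2)) := by
    rw [h1, ← pow_mul]; congr 1; ring
  have h3 : (z * u) ^ (l ^ 2 + l + 1) * u ^ l
      = (y * u) ^ (l * (l + 2)) * (y * u) - (y * u) * u ^ (l * (l + 1)) * u ^ l := by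
    have : (z * u) ^ (l ^ 2 + l + 1) * u ^ l
      = z ^ (l ^ 2 + l + 1) * u ^ (l ^ 2 + l + 1 + l) := by ring
    rw [this, hzF]; ring
  have h4 : (z * u) ^ (l ^ 2 + l + 1) * ((1 + u ^ l) * u) ^ l
      = (1 + u ^ l) ^ l * ((y * u) ^ (l * (l + 2)) * (y * u))
        - (y * u) * u ^ (l * (l + 1)) * ((1 + u ^ l) * u) ^ l := by
    rw [mul_pow (1 + u ^ l)]
    linear_combination (1 + u ^ l) ^ l * h3
  rw [h2] at h4
  linear_combination -h4

variable {n : ℕ} {K : Type*} [Field K]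

/-- Evaluation of regular functions at an affine rational point. -/
noncomputable def evalAt (P : AffinePoint n K) : CoordinateRing n K →ₐ[K] K :=
  Ideal.Quotient.liftₐ _ (aeval ![P.1.1, P.1.2.1, P.1.2.2]) (by
    have : curveIdeal n K ≤ RingHom.ker (aeval ![P.1.1, P.1.2.1, P.1.2.2] :
        MvPolynomial (Fin 3) K →ₐ[K] K).toRingHom := by
      rw [curveIdeal, Ideal.span_le]
      rintro f (rfl | rfl)
      · rw [SetLike.mem_coe, RingHom.mem_ker, map_sub, map_mul, map_h]
        simpa [sub_eq_zero] using P.2.1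
      · simpa [sub_eq_zero] using P.2.2
    exact fun a ha => this ha)

theorem evalAt_coord (P : AffinePoint n K) (i : Fin 3) :
    evalAt P (coord n K i) = ![P.1.1, P.1.2.1, P.1.2.2] i := by
  have : evalAt P (coord n K i) = aeval ![P.1.1, P.1.2.1, P.1.2.2] (X i) := rfl
  rw [this, aeval_X]

variable [Fact (IsPrimePow n)]

theorem xyz_onCurve : OnCurve n (x n K) (y n K) (z n K) :=
  (coord_onCurve n K).map (algebraMap (CoordinateRing n K) (FunctionField n K))

theorem aeval_xyz (g : MvPolynomial (Fin 4) K) : aeval ![x n K, y n K, z n K, 1] g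
    = algebraMap (CoordinateRing n K) (FunctionField n K)
      (aeval ![coord n K 0, coord n K 1, coord n K 2, 1] g) := by
  rw [← aeval_algebraMap_apply]
  congr 2
  funext j
  fin_cases j <;> simp [x, y, z]

theorem eval_affine_eq_zero (P : AffinePoint n K) (g : MvPolynomial (Fin 4) K)
    (hg : aeval ![x n K, y n K, z n K, 1] g = 0) :
    eval ![P.1.1, P.1.2.1, P.1.2.2, 1] g = 0 := by
  rw [aeval_xyz, map_eq_zero_iff _ (IsFractionRing.injective _ _)] at hg
  have h1 := congrArg (evalAt P) hg
  rw [map_zero, comp_aeval_apply] at h1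
  rw [← h1, ← coe_aeval_eq_eval, RingHom.coe_coe]
  congr 2
  funext j
  fin_cases j <;> simp [evalAt_coord]

theorem exists_quotient_xyz (f : FunctionField n K) : ∃ g h : MvPolynomial (Fin 4) K,
    aeval ![x n K, y n K, z n K, 1] h ≠ 0 ∧
    f = aeval ![x n K, y n K, z n K, 1] g / aeval ![x n K, y n K, z n K, 1] h := by
  have hsurj : ∀ r : CoordinateRing n K, ∃ g : MvPolynomial (Fin 4) K,
      algebraMap (CoordinateRing n K) (FunctionField n K) r
        = aeval ![x n K, y n K, z n K, 1] g := by
    intro r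
    obtain ⟨q, rfl⟩ := Ideal.Quotient.mk_surjective r
    refine ⟨rename Fin.castSucc q, ?_⟩
    rw [aeval_xyz, aeval_rename]
    congr 1
    have : Ideal.Quotient.mk (curveIdeal n K) q = Ideal.Quotient.mkₐ K (curveIdeal n K) q := rfl
    rw [this]
    refine DFunLike.congr_fun (algHom_ext fun i => ?_) q
    rw [aeval_X]
    fin_cases i <;> rfl
  obtain ⟨r, s, hs, rfl⟩ := IsFractionRing.div_surjective (A := CoordinateRing n K) f
  obtain ⟨g, hg⟩ := hsurj r
  obtain ⟨h, hh⟩ := hsurj s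
  refine ⟨g, h, ?_, by rw [hg, hh]⟩
  rw [← hh]
  exact IsFractionRing.to_map_ne_zero_of_mem_nonZeroDivisors hs

/-- Points of the curve with distinct first coordinates prevent `x` from being algebraic. -/
theorem x_not_isIntegral (P Q : AffinePoint n K) (hP : P.1.1 = 0) (hQ : Q.1.1 ≠ 0) :
    ¬ IsIntegral K (x n K) := by
  intro hx
  have h1 : IsIntegral K (coord n K 0) :=
    (isIntegral_algebraMap_iff (IsFractionRing.injective (CoordinateRing n K) _)).1 hx
  have h2 := congrArg (evalAt P) (minpoly.aeval K (coord n K 0))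
  rw [← Polynomial.aeval_algHom_apply, evalAt_coord, map_zero] at h2
  simp only [Matrix.cons_val_zero, hP] at h2
  have h3 : (minpoly K (coord n K 0)).coeff 0 = 0 := by
    rw [Polynomial.coeff_zero_eq_aeval_zero]; exact h2
  -- The minimal polynomial vanishes at 0, the value of `x` at `P`; hence `x = 0`, contrary to its
  -- value at `Q`.
  rw [minpoly.coeff_zero_eq_zero h1] at h3
  have h4 := evalAt_coord Q 0
  rw [h3, map_zero] at h4
  exact hQ h4.symm

theorem localRing_affine (v : Fin 4 → K) (hv : v 3 = 1) :
    localRing n v = pointRing ![x n K, y n K, z n K, 1] v := by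
  have := homogeneous_quotients_eq_pointRing (1 : FunctionField n K) one_ne_zero
    ![x n K, y n K, z n K, 1] v 3 rfl hv
  simp only [one_mul] at this
  exact this

/-- The functions `1, y/x, z/x, 1/x`, affine coordinates around the point at infinity. -/
noncomputable def coordInfty (n : ℕ) [Fact (IsPrimePow n)] (K : Type*) [Field K] :
    Fin 4 → FunctionField n K :=
  ![1, y n K / x n K, z n K / x n K, 1 / x n K]

theorem x_mul_coordInfty (hx : x n K ≠ 0) :
    (fun j => x n K * coordInfty n K j) = ![x n K, y n K, z n K, 1] := by
  funext j
  fin_cases j <;> simp [coordInfty, mul_div_cancel₀, hx]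

theorem localRing_infty (hx : x n K ≠ 0) :
    localRing n (![1, 0, 0, 0] : Fin 4 → K) = pointRing (coordInfty n K) (![1, 0, 0, 0] : Fin 4 → K) := by
  have := homogeneous_quotients_eq_pointRing (x n K) hx (coordInfty n K)
    (![1, 0, 0, 0] : Fin 4 → K) 0 rfl rfl
  simp only [x_mul_coordInfty hx] at this
  exact this

/-- The valuation ring of `Q` contains the local ring at `v`, which is the valuation ring of `P`;
such an inclusion forces equality. -/
theorem Place.eq_of_center {v : Fin 4 → K} {t : Fin 4 → FunctionField n K}
    {P Q : Place n K} (hP : P.IsAt v) (ht : localRing n v = pointRing t v)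
    (hQ : ∀ j, Q.val (t j - algebraMap K _ (v j)) < 1) : Q = P := by
  have h1 : P.val = Q.val := by
    refine valuation_eq_of_le _ _ P.surjective Q.surjective fun f hf => ?_
    refine valuation_le_one_of_mem_pointRing Q.val Q.trivial_on_constants t v hQ f ?_
    rw [← ht, ← hP]; exact hf
  cases P; cases Q
  simp only at h1
  subst h1; rfl

section CharP

variable {p k : ℕ} [CharP K p]

theorem charP_functionField : CharP (FunctionField n K) p :=
  charP_of_injective_algebraMap (algebraMap K (FunctionField n K)).injective p

variable [Fact p.Prime]

theorem z_pow_m (hn : n = p ^ k) : z n K ^ m n = y n K ^ n ^ 2 - y n K :=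
  have := charP_functionField (n := n) (K := K) (p := p)
  ((onCurve_iff hn).1 xyz_onCurve).1

/-- By additivity, `(y-b)^(n²) - (y-b) = z^m - c^m` and `(x-a)^n + (x-a) = y^(n+1) - b^(n+1)`. The
left sides are `y-b` and `x-a` times units (`-e₁` and `e₀`), and the right sides are divisible by
`z-c` and `y-b`. -/
theorem exists_affine_place (hn : n = p ^ k) (hx : ¬ IsIntegral K (x n K))
    (P : AffinePoint n K) : ∃ Q : Place n K, Q.IsAt ![P.1.1, P.1.2.1, P.1.2.2, 1] ∧
      Q.val (z n K - algebraMap K _ P.1.2.2) = WithZero.exp (-1) ∧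
      Q.val (y n K - algebraMap K _ P.1.2.1) < 1 ∧
      Q.val (x n K - algebraMap K _ P.1.1) < 1 := by
  have hchar := charP_functionField (n := n) (K := K) (p := p)
  have hn2 : 2 ≤ n := (Fact.out : IsPrimePow n).two_le
  have hev := eval_affine_eq_zero P
  have hzF := z_pow_m (n := n) (K := K) hn
  have hyF := (xyz_onCurve (n := n) (K := K)).2
  obtain ⟨⟨a, b, c⟩, hP⟩ := P
  obtain ⟨hzK, hyK⟩ := (onCurve_iff hn).1 hP
  simp only at hzK hyK hev ⊢
  set t : Fin 4 → FunctionField n K := ![x n K, y n K, z n K, 1] with ht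
  set v : Fin 4 → K := ![a, b, c, 1] with hv
  have ht0 : t 0 = x n K := rfl
  have ht1 : t 1 = y n K := rfl
  have ht2 : t 2 = z n K := rfl
  have hv0 : v 0 = a := rfl
  have hv1 : v 1 = b := rfl
  have hv2 : v 2 = c := rfl
  have hzK' := congrArg (algebraMap K (FunctionField n K)) hzK
  have hyK' := congrArg (algebraMap K (FunctionField n K)) hyK
  simp only [map_pow, map_sub, map_add] at hzK' hyK'
  let w : MvPolynomial (Fin 4) K := X 2 - C c
  have hwt : aeval t w = z n K - algebraMap K _ c := by simp [w, ht2]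
  let e₁ : MvPolynomial (Fin 4) K := 1 - (X 1 - C b) ^ (n ^ 2 - 1)
  let e₀ : MvPolynomial (Fin 4) K := 1 + (X 0 - C a) ^ (n - 1)
  have hn21 : n ^ 2 - 1 + 1 = n ^ 2 := Nat.sub_add_cancel (Nat.one_le_pow _ _ (by omega))
  have hn1 : n - 1 + 1 = n := by omega
  have he₁ : eval v e₁ ≠ 0 := by
    have : n ^ 2 - 1 ≠ 0 := by have := Nat.le_self_pow two_ne_zero n; omega
    simp [e₁, hv1, this]
  have he₀ : eval v e₀ ≠ 0 := by
    have : n - 1 ≠ 0 := by omega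
    simp [e₀, hv0, this]
  obtain ⟨q₁, hq₁⟩ : w ∣ X 2 ^ m n - C c ^ m n := sub_dvd_pow_sub_pow _ _ _
  obtain ⟨q₀, hq₀⟩ : (X 1 - C b : MvPolynomial (Fin 4) K) ∣ X 1 ^ (n + 1) - C b ^ (n + 1) :=
    sub_dvd_pow_sub_pow _ _ _
  replace hq₁ := congrArg (aeval t) hq₁
  replace hq₀ := congrArg (aeval t) hq₀
  rw [map_mul] at hq₁ hq₀
  have hn' : n ^ 2 = p ^ (k * 2) := by rw [hn, pow_mul]
  have hy : aeval t e₁ * (y n K - algebraMap K _ b) = aeval t w * aeval t (-q₁) := by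
    rw [map_neg, mul_neg, ← hq₁]
    simp only [e₁, map_sub, map_pow, map_one, aeval_X, aeval_C, ht1, ht2, sub_mul, one_mul,
      ← pow_succ, hn21]
    rw [sub_pow_of_charP hn', hzF, hzK']
    ring
  have hx' : aeval t e₀ * (x n K - algebraMap K _ a)
      = (y n K - algebraMap K _ b) * aeval t q₀ := by
    have : aeval t (X 1 - C b) = y n K - algebraMap K _ b := by simp [ht1]
    rw [← this, ← hq₀]
    simp only [e₀, map_sub, map_add, map_pow, map_one, aeval_X, aeval_C, ht1, ht0, add_mul,
      one_mul, ← pow_succ, hn1]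
    rw [sub_pow_of_charP hn, ← hyF, ← hyK']
    ring
  have hx'' : aeval t (e₀ * e₁) * (x n K - algebraMap K _ a)
      = aeval t w * aeval t (-q₁ * q₀) := by
    rw [map_mul, map_mul]
    linear_combination aeval t e₁ * hx' + aeval t q₀ * hy
  have hne : ∀ g, eval v g ≠ 0 → aeval t g ≠ 0 := fun g hg h0 => hg (hev g h0)
  have he : eval v (e₀ * e₁) ≠ 0 := by rw [map_mul]; exact mul_ne_zero he₀ he₁
  have hw0 : aeval t w ≠ 0 := by
    -- If `z` were the constant `c`, then `x` would be the constant `a`.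
    intro h0
    rw [h0, zero_mul, mul_eq_zero, or_iff_right (hne _ he), sub_eq_zero] at hx''
    exact hx (hx'' ▸ isIntegral_algebraMap)
  have hwv : eval v w = 0 := by simp [w, hv2]
  obtain ⟨val, h1, h2, h3, h4, h5⟩ := exists_valuation_of_uniformizer t v hev w hwv hw0
    (by
      intro j
      fin_cases j
      · exact ⟨_, _, he, hx''⟩
      · exact ⟨_, _, he₁, hy⟩
      · exact ⟨1, 1, by simp, by simp [w, ht2, hv2]⟩
      · exact ⟨1, 0, by simp, by simp [t, v]⟩)
    exists_quotient_xyz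
  refine ⟨⟨val, h1, h2⟩, ?_, by rw [← hwt]; exact h4, h5 1, h5 0⟩
  change {f | val f ≤ 1} = _
  rw [h3, localRing_affine _ rfl]

/-- The equations of the curve in the coordinates `u = 1/x`, `v = y/x`, `w = z/x`. -/
theorem infty_relations (hn : n = p ^ k) (hx : x n K ≠ 0) (hy : y n K ≠ 0) :
    (1 + (1 / x n K) ^ (n - 1)) * (1 / x n K) = (y n K / x n K) ^ (n + 1) ∧
    ((1 + (1 / x n K) ^ (n - 1)) ^ (n - 1) - (1 / x n K) ^ ((n - 1) * n)) * (y n K / x n K)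
      = (z n K / x n K) ^ m n := by
  have hn2 : 2 ≤ n := (Fact.out : IsPrimePow n).two_le
  have hm : m n = (n - 1) ^ 2 + (n - 1) + 1 := by
    obtain ⟨l, rfl⟩ : ∃ l, n = l + 1 := ⟨n - 1, by omega⟩
    have : (l + 1) ^ 2 = l ^ 2 + l + (l + 1) := by ring
    rw [m, this, Nat.add_sub_cancel, Nat.add_sub_cancel]
  have hl : n - 1 + 1 = n := by omega
  have := inverted_relations (n - 1) hx hy
    (by rw [hl]; exact (xyz_onCurve (n := n) (K := K)).2)
    (by rw [← hm, hl]; exact z_pow_m hn)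
  rwa [← hm, hl] at this

end CharP

end Places
-- The place at infinity
section Infinity

variable {n : ℕ} {K : Type*} [Field K] [Fact (IsPrimePow n)] {p k : ℕ} [CharP K p] [Fact p.Prime]

theorem isIntegral_x_of_y (hy : IsIntegral K (y n K)) : IsIntegral K (x n K) := by
  have hn2 : 2 ≤ n := (Fact.out : IsPrimePow n).two_le
  have hd : (Polynomial.X ^ n + Polynomial.X : Polynomial K).Monic :=
    Polynomial.monic_X_pow_add (by rw [Polynomial.degree_X]; exact_mod_cast hn2)
  refine IsIntegral.of_aeval_monic hd ?_ ?_
  · rw [Polynomial.natDegree_add_eq_left_of_natDegree_lt] <;> simp <;> omega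
  · have := (xyz_onCurve (n := n) (K := K)).2
    simp only [map_add, map_pow, Polynomial.aeval_X, this]
    exact hy.pow _

theorem isIntegral_y_of_z (hn : n = p ^ k) (hz : IsIntegral K (z n K)) :
    IsIntegral K (y n K) := by
  have hn2 : 2 ≤ n := (Fact.out : IsPrimePow n).two_le
  have hn4 : 1 < n ^ 2 := Nat.one_lt_pow two_ne_zero hn2
  have hd : (Polynomial.X ^ n ^ 2 - Polynomial.X : Polynomial K).Monic :=
    Polynomial.monic_X_pow_sub (by rw [Polynomial.degree_X]; exact_mod_cast hn4)
  refine IsIntegral.of_aeval_monic hd ?_ ?_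
  · rw [FiniteField.X_pow_card_sub_X_natDegree_eq K hn4]; omega
  · simp only [map_sub, map_pow, Polynomial.aeval_X, ← z_pow_m hn]
    exact hz.pow _

/-- At a pole of `x`, the valuation is determined by the value of `z / x`. -/
theorem valuation_at_pole {Γ : Type*} [LinearOrderedCommGroupWithZero Γ] (hn : n = p ^ k)
    (hy : y n K ≠ 0) (val : Valuation (FunctionField n K) Γ) (hx : 1 < val (x n K)) :
    val (1 / x n K) < 1 ∧ val (1 / x n K) = val (z n K / x n K) ^ (m n * (n + 1)) ∧
      val (y n K / x n K) = val (z n K / x n K) ^ m n := by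
  have hn2 : 2 ≤ n := (Fact.out : IsPrimePow n).two_le
  have hx0 : x n K ≠ 0 := by intro h0; rw [h0, map_zero] at hx; exact not_lt_zero hx
  obtain ⟨h1, h2⟩ := infty_relations hn hx0 hy
  have hu : val (1 / x n K) < 1 := by
    rw [map_div₀, map_one, one_div]; exact inv_lt_one_of_one_lt₀ hx
  have hE : val (1 + (1 / x n K) ^ (n - 1)) = 1 := by
    apply Valuation.map_one_add_of_lt
    rw [map_pow]; exact pow_lt_one₀ zero_le hu (by omega)
  have hD : val ((1 + (1 / x n K) ^ (n - 1)) ^ (n - 1) - (1 / x n K) ^ ((n - 1) * n)) = 1 := by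
    rw [Valuation.map_sub_eq_of_lt_left]
    · rw [map_pow, hE, one_pow]
    · rw [map_pow, map_pow, hE, one_pow]
      exact pow_lt_one₀ zero_le hu (Nat.mul_ne_zero (Nat.sub_ne_zero_of_lt hn2) (by positivity))
  have h1' := congrArg val h1
  have h2' := congrArg val h2
  rw [map_mul, hE, one_mul, map_pow] at h1'
  rw [map_mul, hD, one_mul, map_pow] at h2'
  exact ⟨hu, by rw [h1', h2', ← pow_mul], h2'⟩

theorem valuation_coordInfty_lt {Γ : Type*} [LinearOrderedCommGroupWithZero Γ] (hn : n = p ^ k)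
    (hy : y n K ≠ 0) (val : Valuation (FunctionField n K) Γ) (hx : 1 < val (x n K)) (j : Fin 4) :
    val (coordInfty n K j - algebraMap K _ ((![1, 0, 0, 0] : Fin 4 → K) j)) < 1 := by
  obtain ⟨h1, h2, h3⟩ := valuation_at_pole hn hy val hx
  have hw : val (z n K / x n K) < 1 := by
    rw [h2] at h1
    exact (pow_lt_one_iff (Nat.mul_ne_zero (Nat.succ_ne_zero _) (Nat.succ_ne_zero _))).1 h1
  have hv : val (y n K / x n K) < 1 := by
    rw [h3]; exact pow_lt_one₀ zero_le hw (Nat.succ_ne_zero _)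
  fin_cases j
  · simp [coordInfty]
  · simpa [coordInfty] using hv
  · simpa [coordInfty] using hw
  · simpa [coordInfty] using h1

/-- The integral closure of `K` is the intersection of the valuation rings containing it. -/
theorem exists_valuationSubring_notMem {F : Type*} [Field F] [Algebra K F] {f : F}
    (hf : ¬ IsIntegral K f) : ∃ V : ValuationSubring F, (∀ c : K, algebraMap K F c ∈ V) ∧ f ∉ V := by
  have : IsIntegrallyClosedIn (integralClosure K F).toSubring F :=
    inferInstanceAs (IsIntegrallyClosedIn (integralClosure K F) F)
  obtain ⟨V, h1, h2⟩ := Subring.exists_le_valuationSubring_of_isIntegrallyClosedIn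
    (R := (integralClosure K F).toSubring) (x := f) hf
  exact ⟨V, fun c => h1 ((integralClosure K F).algebraMap_mem c), h2⟩

theorem exists_infty_place (hn : n = p ^ k) (hx : ¬ IsIntegral K (x n K)) :
    ∃ Q : Place n K, Q.IsAt ![1, 0, 0, 0] ∧
      Q.val (z n K / x n K) = WithZero.exp (-1) ∧ 1 < Q.val (x n K) := by
  have hn2 : 2 ≤ n := (Fact.out : IsPrimePow n).two_le
  have hx0 : x n K ≠ 0 := fun h0 => hx (h0 ▸ isIntegral_zero)
  have hy0 : y n K ≠ 0 := fun h0 => hx (isIntegral_x_of_y (h0 ▸ isIntegral_zero))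
  have hz0 : z n K ≠ 0 := fun h0 =>
    hx (isIntegral_x_of_y (isIntegral_y_of_z hn (h0 ▸ isIntegral_zero)))
  -- An auxiliary, possibly non-discrete, pole of `x`. It serves only to show that evaluation at
  -- `(1:0:0:0)` respects the relations among the coordinates at infinity.
  obtain ⟨V, hV, hxV⟩ := exists_valuationSubring_notMem hx
  have hK : ∀ c : K, c ≠ 0 → V.valuation (algebraMap K _ c) = 1 := by
    intro c hc
    refine le_antisymm ((V.valuation_le_one_iff _).2 (hV c)) ?_
    have := (V.valuation_le_one_iff _).2 (hV c⁻¹)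
    rw [map_inv₀, map_inv₀] at this
    refine (inv_le_one₀ (zero_lt_iff.2 ?_)).1 this
    rw [Ne, map_eq_zero, map_eq_zero]; exact hc
  have hev := eval_eq_zero_of_valuation V.valuation hK (coordInfty n K) _
    (valuation_coordInfty_lt hn hy0 V.valuation
      (not_le.1 fun h => hxV ((V.valuation_le_one_iff _).1 h)))
  obtain ⟨h1, h2⟩ := infty_relations hn hx0 hy0
  have ht1 : coordInfty n K 1 = y n K / x n K := rfl
  have ht2 : coordInfty n K 2 = z n K / x n K := rfl
  have ht3 : coordInfty n K 3 = 1 / x n K := rfl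
  -- The relations read `E u = v^(n+1)` and `D v = w^m`, where `E` and `D` take the value 1 at the
  -- point.
  let E : MvPolynomial (Fin 4) K := 1 + X 3 ^ (n - 1)
  let D : MvPolynomial (Fin 4) K := E ^ (n - 1) - X 3 ^ ((n - 1) * n)
  have hE : eval (![1, 0, 0, 0] : Fin 4 → K) E = 1 := by
    have : n - 1 ≠ 0 := by omega
    simp [E, this]
  have hD : eval (![1, 0, 0, 0] : Fin 4 → K) D = 1 := by
    have h1 : n - 1 ≠ 0 := by omega
    have h2 : n ≠ 0 := by omega
    simp only [D, map_sub, map_pow, hE]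
    simp [h1, h2]
  have hEt : aeval (coordInfty n K) E = 1 + (1 / x n K) ^ (n - 1) := by simp [E, ht3]
  have hDt : aeval (coordInfty n K) D
      = (1 + (1 / x n K) ^ (n - 1)) ^ (n - 1) - (1 / x n K) ^ ((n - 1) * n) := by
    simp only [D, map_sub, map_pow, hEt, aeval_X, ht3]
  rw [← hEt] at h1
  rw [← hDt] at h2
  have hm : m n = (m n - 1) + 1 := rfl
  have hfrac : ∀ f : FunctionField n K, ∃ g h : MvPolynomial (Fin 4) K,
      aeval (coordInfty n K) h ≠ 0 ∧
      f = aeval (coordInfty n K) g / aeval (coordInfty n K) h := by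
    intro f
    obtain ⟨g, h, hh, rfl⟩ := exists_quotient_xyz f
    rw [← x_mul_coordInfty hx0] at hh ⊢
    exact exists_quotient _ hx0 _ 3 (by rw [ht3, mul_one_div_cancel hx0]) g h hh
  obtain ⟨val, h3, h4, h5, h6, h7⟩ := exists_valuation_of_uniformizer (coordInfty n K)
    (![1, 0, 0, 0] : Fin 4 → K) hev (X 2) (by simp)
    (by rw [aeval_X, ht2]; exact div_ne_zero hz0 hx0)
    (by
      intro j
      fin_cases j
      · exact ⟨1, 0, by simp, by simp [coordInfty]⟩
      · refine ⟨D, X 2 ^ (m n - 1), by rw [hD]; exact one_ne_zero, ?_⟩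
        rw [← map_mul, ← pow_succ', ← hm, map_pow, aeval_X, ht2, ← h2]
        simp [ht1]
      · exact ⟨1, 1, by simp, by simp⟩
      · refine ⟨D * E, X 2 ^ (m n - 1) * X 1 ^ n, by simp [hD, hE], ?_⟩
        rw [← map_mul, ← mul_assoc, ← pow_succ', ← hm, map_mul, map_mul, map_pow, map_pow,
          aeval_X, aeval_X, ht2, ht1, ← h2]
        simp only [Fin.reduceFinMk, ht3]
        have : (![1, 0, 0, 0] : Fin 4 → K) 3 = 0 := rfl
        rw [this, map_zero, sub_zero]
        linear_combination aeval (coordInfty n K) D * h1)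
    hfrac
  rw [aeval_X] at h6
  refine ⟨⟨val, h3, h4⟩, ?_, h6, ?_⟩
  · change {f | val f ≤ 1} = _
    rw [h5, localRing_infty hx0]
  · have := h7 3
    change val (1 / x n K - algebraMap K _ 0) < 1 at this
    rw [map_zero, sub_zero, map_div₀, map_one, one_div] at this
    exact (inv_lt_one₀ (zero_lt_iff.2 (val.ne_zero_iff.2 hx0))).1 this

end Infinity

/-! ### Orders of the coordinates and location of their zeros -/

section Divisors

variable {n : ℕ} {K : Type*} [Field K] [Fact (IsPrimePow n)]

theorem isDivisorOf_sum_sub {ι : Type*} [Fintype ι] {f : FunctionField n K} (hf : f ≠ 0)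
    {P : ι → Place n K} (hP : Function.Injective P) {Pinf : Place n K} {d e : ℤ}
    (hne : ∀ i, P i ≠ Pinf) (hd : ∀ i, (P i).val f = WithZero.exp (-d))
    (he : Pinf.val f = WithZero.exp e)
    (hrest : ∀ Q : Place n K, Q.val f ≠ 1 → Q = Pinf ∨ ∃ i, Q = P i) :
    IsDivisorOf f (∑ i, Finsupp.single (P i) d - Finsupp.single Pinf e) := by
  classical
  refine ⟨hf, fun Q => ?_⟩
  rw [Finsupp.sub_apply, Finsupp.finsetSum_apply, Place.ord]
  by_cases h1 : Q = Pinf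
  · subst h1
    rw [he, WithZero.log_exp, Finsupp.single_eq_same, Finset.sum_eq_zero, zero_sub]
    exact fun i _ => Finsupp.single_eq_of_ne (hne i).symm
  · rw [Finsupp.single_eq_of_ne h1, sub_zero]
    by_cases h2 : ∃ i, Q = P i
    · obtain ⟨i, rfl⟩ := h2
      rw [hd, WithZero.log_exp, neg_neg, Finset.sum_eq_single i, Finsupp.single_eq_same]
      · exact fun j _ hj => Finsupp.single_eq_of_ne (hP.ne hj.symm)
      · exact fun h => absurd (Finset.mem_univ i) h
    · have h3 : Q.val f = 1 := by
        by_contra h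
        rcases hrest Q h with h | h
        · exact h1 h
        · exact h2 h
      rw [h3, WithZero.log_one, neg_zero, Finset.sum_eq_zero]
      exact fun i _ => Finsupp.single_eq_of_ne fun h => h2 ⟨i, h⟩

variable {p k : ℕ} [CharP K p] [Fact p.Prime]

/-- Both elements are `s` times `±1 + s^(d-1)`, a unit up to sign. -/
theorem val_pow_add_self_of_lt {Γ F : Type*} [LinearOrderedCommGroupWithZero Γ] [Field F]
    (val : Valuation F Γ) {s : F} (hs : val s < 1) {d : ℕ} (hd : 2 ≤ d) :
    val (s ^ d + s) = val s ∧ val (s ^ d - s) = val s := by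
  obtain ⟨l, rfl⟩ : ∃ l, d = l + 1 := ⟨d - 1, by omega⟩
  have h1 : val (s ^ l) < 1 := by rw [map_pow]; exact pow_lt_one₀ zero_le hs (by omega)
  constructor
  · rw [show s ^ (l + 1) + s = s * (1 + s ^ l) by ring, map_mul,
      Valuation.map_one_add_of_lt val h1, mul_one]
  · rw [show s ^ (l + 1) - s = -(s * (1 - s ^ l)) by ring, Valuation.map_neg, map_mul,
      Valuation.map_one_sub_of_lt val h1, mul_one]

theorem val_x_of_lt (Q : Place n K) (hx : Q.val (x n K) < 1) :
    Q.val (x n K) = Q.val (y n K) ^ (n + 1) := by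
  rw [← map_pow, ← (xyz_onCurve (n := n) (K := K)).2,
    (val_pow_add_self_of_lt Q.val hx (Fact.out : IsPrimePow n).two_le).1]

theorem val_y_of_lt (hn : n = p ^ k) (Q : Place n K) (hy : Q.val (y n K) < 1) :
    Q.val (y n K) = Q.val (z n K) ^ m n := by
  have hn2 : 2 ≤ n := (Fact.out : IsPrimePow n).two_le
  rw [← map_pow, z_pow_m hn,
    (val_pow_add_self_of_lt Q.val hy (hn2.trans (Nat.le_self_pow two_ne_zero n))).2]

theorem val_y_le_one (Q : Place n K) (hx : Q.val (x n K) ≤ 1) : Q.val (y n K) ≤ 1 := by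
  rw [← pow_le_one_iff (Nat.succ_ne_zero n), ← map_pow, ← (xyz_onCurve (n := n) (K := K)).2]
  refine (Q.val.map_add _ _).trans (max_le ?_ hx)
  rw [map_pow]; exact pow_le_one₀ zero_le hx

theorem val_z_le_one (hn : n = p ^ k) (Q : Place n K) (hx : Q.val (x n K) ≤ 1) :
    Q.val (z n K) ≤ 1 := by
  have hy := val_y_le_one Q hx
  rw [← pow_le_one_iff (Nat.succ_ne_zero _ : m n ≠ 0), ← map_pow, z_pow_m hn]
  refine (Q.val.map_sub _ _).trans (max_le ?_ hy)
  rw [map_pow]; exact pow_le_one₀ zero_le hy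

/-- A zero of `y` is centred at a point `(a, 0, 0)`. -/
theorem exists_center_of_val_y_lt [Fintype K] (hn : n = p ^ k)
    (hK : Fintype.card K = (n ^ 3) ^ 2) (Q : Place n K) (hy : Q.val (y n K) < 1) :
    ∃ a : {a : K // a ^ n + a = 0}, Q.val (x n K - algebraMap K _ a.1) < 1 := by
  have hn2 : 2 ≤ n := (Fact.out : IsPrimePow n).two_le
  have hs := (trace_poly_splits_and_card hn hn2 hK (β := 0) (zero_pow (by omega))).1
  rw [map_zero, sub_zero] at hs
  obtain ⟨a, ha, h⟩ := exists_root_of_splits Q.val hs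
    (Polynomial.monic_X_pow_add (by rw [Polynomial.degree_X]; exact_mod_cast hn2))
    (s := x n K) (by
      simp only [map_add, map_pow, Polynomial.aeval_X]
      rw [(xyz_onCurve (n := n) (K := K)).2, map_pow]
      exact pow_lt_one₀ zero_le hy (Nat.succ_ne_zero _))
  exact ⟨⟨a, by simpa using ha⟩, h⟩

/-- A zero of `z` is centred at a rational point `(a, b, 0)`. -/
theorem exists_center_of_val_z_lt [Fintype K] (hn : n = p ^ k)
    (hK : Fintype.card K = (n ^ 3) ^ 2) (Q : Place n K) (hz : Q.val (z n K) < 1) :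
    ∃ P : {P : AffinePoint n K // P.1.2.2 = 0}, Q.val (x n K - algebraMap K _ P.1.1.1) < 1 ∧
      Q.val (y n K - algebraMap K _ P.1.1.2.1) < 1 := by
  have hn2 : 2 ≤ n := (Fact.out : IsPrimePow n).two_le
  have hn4 : 1 < n ^ 2 := Nat.one_lt_pow two_ne_zero hn2
  obtain ⟨b, hb, hyb⟩ := exists_root_of_splits Q.val
    (X_pow_sq_sub_X_splits_and_card (K := K) hn2 hK).1
    (Polynomial.monic_X_pow_sub (by rw [Polynomial.degree_X]; exact_mod_cast hn4))
    (s := y n K) (by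
      simp only [map_sub, map_pow, Polynomial.aeval_X]
      rw [← z_pow_m hn, map_pow]
      exact pow_lt_one₀ zero_le hz (Nat.succ_ne_zero _))
  replace hb : b ^ n ^ 2 = b := by simpa [sub_eq_zero] using hb
  -- Reduction of a polynomial in one variable: `y^(n+1)` is congruent to `b^(n+1)`, so `x` nearly
  -- solves the trace equation for `b`.
  have h1 := valuation_aeval_sub_lt Q.val Q.trivial_on_constants (fun _ : Unit => y n K)
    (fun _ => b) (fun _ => hyb) (X () ^ (n + 1))
  simp only [map_pow, aeval_X, eval_X] at h1
  obtain ⟨a, ha, hxa⟩ := exists_root_of_splits Q.val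
    (trace_poly_splits_and_card hn hn2 hK (norm_pow_eq hb)).1
    (by
      rw [add_sub_assoc]
      refine Polynomial.monic_X_pow_add ?_
      rw [Polynomial.degree_X_sub_C]; exact_mod_cast hn2)
    (s := x n K) (by
      have := (xyz_onCurve (n := n) (K := K)).2
      simp only [map_sub, map_add, map_pow, Polynomial.aeval_X, Polynomial.aeval_C, this]
      exact h1)
  replace ha : a ^ n + a = b ^ (n + 1) := by simpa [sub_eq_zero] using ha
  refine ⟨⟨⟨(a, b, 0), (onCurve_iff hn).2 ⟨by simp [hb, m], ha⟩⟩, rfl⟩, hxa, hyb⟩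

theorem Place.eq_of_affine_center {P : AffinePoint n K} {Q R : Place n K}
    (hR : R.IsAt ![P.1.1, P.1.2.1, P.1.2.2, 1]) (hx : Q.val (x n K - algebraMap K _ P.1.1) < 1)
    (hy : Q.val (y n K - algebraMap K _ P.1.2.1) < 1)
    (hz : Q.val (z n K - algebraMap K _ P.1.2.2) < 1) : Q = R := by
  refine Place.eq_of_center hR (localRing_affine _ rfl) fun j => ?_
  fin_cases j
  · exact hx
  · exact hy
  · exact hz
  · simp

theorem eq_of_val_sub_lt (Q : Place n K) {f : FunctionField n K} {a b : K}
    (ha : Q.val (f - algebraMap K _ a) < 1) (hb : Q.val (f - algebraMap K _ b) < 1) : a = b := by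
  by_contra hab
  have h1 := Q.trivial_on_constants (b - a) (sub_ne_zero.2 (Ne.symm hab))
  have h2 : algebraMap K (FunctionField n K) (b - a)
      = (f - algebraMap K _ a) - (f - algebraMap K _ b) := by rw [map_sub]; ring
  rw [h2] at h1
  exact (h1 ▸ Q.val.map_sub_lt ha hb).false

end Divisors
end GK

/-! ### The three divisors -/

open GK in
theorem mainTheorem3 (n : ℕ) [Fact (IsPrimePow n)] (K : Type*) [Field K] [Fintype K]
    [DecidableEq K] (hK : Fintype.card K = (n ^ 3) ^ 2) :
    ∃ (P : GK.AffinePoint n K → GK.Place n K) (Pinf : GK.Place n K),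
      (∀ p : GK.AffinePoint n K, (P p).IsAt ![p.1.1, p.1.2.1, p.1.2.2, 1]) ∧
      Pinf.IsAt ![1, 0, 0, 0] ∧
      GK.IsDivisorOf (GK.x n K)
        (Finsupp.single (P GK.AffinePoint.origin) ((n : ℤ) ^ 3 + 1)
          - Finsupp.single Pinf ((n : ℤ) ^ 3 + 1)) ∧
      Fintype.card {a : K // a ^ n + a = 0} = n ∧
      GK.IsDivisorOf (GK.y n K)
        (∑ a : {a : K // a ^ n + a = 0},
            Finsupp.single (P (GK.AffinePoint.ofRoot a)) ((n : ℤ) ^ 2 - n + 1)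
          - Finsupp.single Pinf ((n : ℤ) * ((n : ℤ) ^ 2 - n + 1))) ∧
      (∀ a b : K, GK.OnCurve n a b 0 ↔
        a ^ n ^ 2 = a ∧ b ^ n ^ 2 = b ∧ a ^ n + a = b ^ (n + 1)) ∧
      Fintype.card {p : GK.AffinePoint n K // p.1.2.2 = 0} = n ^ 3 ∧
      GK.IsDivisorOf (GK.z n K)
        (∑ p : {p : GK.AffinePoint n K // p.1.2.2 = 0}, Finsupp.single (P p.1) (1 : ℤ)
          - Finsupp.single Pinf ((n : ℤ) ^ 3)) := by
  have hn2 : 2 ≤ n := (Fact.out : IsPrimePow n).two_le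
  obtain ⟨p, k, hp, hchar, hn⟩ := exists_charP_of_card Fact.out hK
  have hcard : Fintype.card {a : K // a ^ n + a = 0} = n := by
    rw [← Nat.card_eq_fintype_card]
    exact (trace_poly_splits_and_card hn hn2 hK (zero_pow (by omega))).2
  have hx : ¬ IsIntegral K (x n K) := by
    -- Since `n ≥ 2`, some `(a, 0, 0)` with `a ≠ 0` lies on the curve besides the origin, so `x` is
    -- not constant.
    have : Nontrivial {a : K // a ^ n + a = 0} := by
      rw [← Fintype.one_lt_card_iff_nontrivial, hcard]; exact hn2
    obtain ⟨a, ha⟩ := exists_ne (⟨0, by simp; omega⟩ : {a : K // a ^ n + a = 0})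
    exact x_not_isIntegral AffinePoint.origin (AffinePoint.ofRoot a) rfl
      fun h => ha (Subtype.ext h)
  have hx0 : x n K ≠ 0 := fun h0 => hx (h0 ▸ isIntegral_zero)
  have hy0 : y n K ≠ 0 := fun h0 => hx (isIntegral_x_of_y (h0 ▸ isIntegral_zero))
  have hz0 : z n K ≠ 0 := fun h0 =>
    hx (isIntegral_x_of_y (isIntegral_y_of_z hn (h0 ▸ isIntegral_zero)))
  choose P hP hPz hPy hPx using exists_affine_place hn hx
  obtain ⟨Pinf, hPi, hPiw, hPix⟩ := exists_infty_place hn hx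
  have hexp : WithZero.exp (-1 : ℤ) < 1 := by
    rw [← WithZero.exp_zero, WithZero.exp_lt_exp]; norm_num
  have hPinj : Function.Injective P := by
    intro p q hpq
    have h1 := hPx p
    have h2 := hPy p
    have h3 := (hPz p).trans_lt hexp
    rw [hpq] at h1 h2 h3
    exact Subtype.ext (Prod.ext (eq_of_val_sub_lt _ h1 (hPx q))
      (Prod.ext (eq_of_val_sub_lt _ h2 (hPy q))
        (eq_of_val_sub_lt _ h3 ((hPz q).trans_lt hexp))))
  have hinf : ∀ Q : Place n K, 1 < Q.val (x n K) → Q = Pinf := fun Q hQ =>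
    Place.eq_of_center hPi (localRing_infty hx0) (valuation_coordInfty_lt hn hy0 Q.val hQ)
  have hPne : ∀ p, P p ≠ Pinf := by
    intro p h
    have h1 := (P p).val.map_add (x n K - algebraMap K _ p.1.1) (algebraMap K _ p.1.1)
    rw [sub_add_cancel] at h1
    rw [← h] at hPix
    refine (h1.trans_lt' hPix).not_ge (max_le (hPx p).le ?_)
    by_cases hc : p.1.1 = 0
    · simp [hc]
    · exact ((P p).trivial_on_constants _ hc).le
  have hmZ : (m n : ℤ) = (n : ℤ) ^ 2 - n + 1 := by
    have : n ≤ n ^ 2 := Nat.le_self_pow two_ne_zero n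
    rw [m]; push_cast [this]; ring
  have hm3 : ((n : ℤ) + 1) * ((n : ℤ) ^ 2 - n + 1) = (n : ℤ) ^ 3 + 1 := by ring
  have hpow : ∀ d : ℕ, WithZero.exp (-1 : ℤ) ^ d = WithZero.exp (-(d : ℤ)) := fun d => by
    rw [← WithZero.exp_nsmul]; simp
  -- With `z/x` of order 1, `y/x` has order `m` and `1/x` order `m(n+1) = n³ + 1`; so `y` has order
  -- `m - m(n+1) = -nm` and `z` has order `-n³`.
  obtain ⟨-, hiu, hiv⟩ := valuation_at_pole hn hy0 Pinf.val hPix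
  rw [hPiw, hpow] at hiu hiv
  have hix : Pinf.val (x n K) = WithZero.exp ((n : ℤ) ^ 3 + 1) := by
    rw [map_div₀, map_one, one_div, inv_eq_iff_eq_inv, ← WithZero.exp_neg, neg_neg] at hiu
    rw [hiu, ← hm3, ← hmZ]; push_cast; ring_nf
  have hiy : Pinf.val (y n K) = WithZero.exp ((n : ℤ) * ((n : ℤ) ^ 2 - n + 1)) := by
    rw [map_div₀, div_eq_iff (Pinf.val.ne_zero_iff.2 hx0), hix, ← WithZero.exp_add, hmZ] at hiv
    rw [hiv]; ring_nf
  have hiz : Pinf.val (z n K) = WithZero.exp ((n : ℤ) ^ 3) := by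
    rw [map_div₀, div_eq_iff (Pinf.val.ne_zero_iff.2 hx0), hix, ← WithZero.exp_add] at hPiw
    rw [hPiw]; ring_nf
  have hrest : ∀ (Q : Place n K) (f : FunctionField n K),
      (Q.val (x n K) ≤ 1 → Q.val f ≤ 1) → Q.val f ≠ 1 → Q = Pinf ∨ Q.val f < 1 := by
    intro Q f h1 h2
    rcases le_or_gt (Q.val (x n K)) 1 with h | h
    · exact Or.inr (lt_of_le_of_ne (h1 h) h2)
    · exact Or.inl (hinf Q h)
  have hvz : ∀ p : AffinePoint n K, p.1.2.2 = 0 →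
      (P p).val (z n K) = WithZero.exp (-1) := by
    intro p h
    have := hPz p
    rwa [h, map_zero, sub_zero] at this
  have hvy : ∀ a, (P (AffinePoint.ofRoot a)).val (y n K)
      = WithZero.exp (-((n : ℤ) ^ 2 - n + 1)) := by
    intro a
    have := hPy (AffinePoint.ofRoot a)
    change (P (AffinePoint.ofRoot a)).val (y n K - algebraMap K _ 0) < 1 at this
    rw [map_zero, sub_zero] at this
    rw [val_y_of_lt hn _ this, hvz _ rfl, hpow, hmZ]
  have hvx : (P AffinePoint.origin).val (x n K) = WithZero.exp (-((n : ℤ) ^ 3 + 1)) := by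
    have := hPx AffinePoint.origin
    change (P AffinePoint.origin).val (x n K - algebraMap K _ 0) < 1 at this
    rw [map_zero, sub_zero] at this
    have h0 : (AffinePoint.origin : AffinePoint n K)
        = AffinePoint.ofRoot ⟨0, by simp; omega⟩ := rfl
    rw [val_x_of_lt _ this, h0, hvy, ← WithZero.exp_nsmul, ← hm3, nsmul_eq_mul]
    push_cast; ring_nf
  have hylt : ∀ Q : Place n K, Q.val (x n K) < 1 → Q.val (y n K) < 1 := fun Q h => by
    have := val_x_of_lt Q h
    rw [this] at h
    exact (pow_lt_one_iff (Nat.succ_ne_zero _)).1 h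
  have hzlt : ∀ Q : Place n K, Q.val (y n K) < 1 → Q.val (z n K) < 1 := fun Q h => by
    have := val_y_of_lt hn Q h
    rw [this] at h
    exact (pow_lt_one_iff (Nat.succ_ne_zero _)).1 h
  refine ⟨P, Pinf, hP, hPi, ?_, hcard, ?_, onCurve_zero_iff hn, ?_, ?_⟩
  · have := isDivisorOf_sum_sub (ι := Unit) hx0 (P := fun _ => P AffinePoint.origin)
      (fun _ _ _ => rfl) (fun _ => hPne _) (fun _ => hvx) hix (fun Q hQ => by
        refine (hrest Q _ id hQ).imp_right fun h => ⟨(), ?_⟩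
        refine Place.eq_of_affine_center (hP _) ?_ ?_ ?_
        · change Q.val (x n K - algebraMap K _ 0) < 1
          rwa [map_zero, sub_zero]
        · change Q.val (y n K - algebraMap K _ 0) < 1
          rw [map_zero, sub_zero]; exact hylt Q h
        · change Q.val (z n K - algebraMap K _ 0) < 1
          rw [map_zero, sub_zero]; exact hzlt Q (hylt Q h))
    simpa using this
  · refine isDivisorOf_sum_sub hy0 (fun a b h => ?_) (fun _ => hPne _) hvy hiy fun Q hQ => ?_
    · exact Subtype.ext (congrArg (fun q : AffinePoint n K => q.1.1) (hPinj h))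
    · refine (hrest Q _ (val_y_le_one Q) hQ).imp_right fun h => ?_
      obtain ⟨a, ha⟩ := exists_center_of_val_y_lt hn hK Q h
      refine ⟨a, Place.eq_of_affine_center (hP _) ha ?_ ?_⟩
      · change Q.val (y n K - algebraMap K _ 0) < 1
        rwa [map_zero, sub_zero]
      · change Q.val (z n K - algebraMap K _ 0) < 1
        rw [map_zero, sub_zero]; exact hzlt Q h
  · rw [← Nat.card_eq_fintype_card]
    exact card_affinePoint_zero hn hn2 hK
  · refine isDivisorOf_sum_sub hz0 (hPinj.comp Subtype.val_injective) (fun _ => hPne _)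
      (fun q => hvz _ q.2) hiz fun Q hQ => ?_
    refine (hrest Q _ (val_z_le_one hn Q) hQ).imp_right fun h => ?_
    obtain ⟨q, h1, h2⟩ := exists_center_of_val_z_lt hn hK Q h
    refine ⟨q, Place.eq_of_affine_center (hP _) h1 h2 ?_⟩
    rwa [q.2, map_zero, sub_zero]
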